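/- Let $p$ be a prime, $d\ge 1$ an integer, and let $\mathbb{C}_p$ be the completion of an algebraic closure of $\mathbb{Q}_p$, with its absolute value $|\cdot|_p$. Let $W=\mathbb{Q}_p^d\oplus\mathbb{Q}_p^d$ (row vectors) carry the symplectic form $\omega((x_1,y_1),(x_2,y_2))=x_1\cdot y_2-y_1\cdot x_2$, and let $\mathcal{H}$ be the Heisenberg group with underlying set $W\times\mathbb{Q}_p$ and multiplication $[w_1,t_1][w_2,t_2]=[w_1+w_2,\,t_1+t_2+\tfrac12\omega(w_1,w_2)]$. Fix a non-trivial character $\psi:(\mathbb{Q}_p,+)\to\mathbb{C}_p^\times$ with open kernel. Let $\mathcal{S}$ be the space of locally constant, compactly supported functions $\mathbb{Q}_p^d\to\mathbb{C}_p$, with the Schrödinger representation $$(\rho_\psi([(a,b),t])f)(x)=\psi\left(t+\tfrac12 a\cdot b+b\cdot x\right)f(x+a).$$ The group $\mathrm{Sp}_{2d}(\mathbb{Q}_p)$ acts on $\mathcal{H}$ from the right by $[w,t]\cdot g=[wg,t]$. For each $g\in \mathrm{Sp}_{2d}(\mathbb{Q}_p)$ there is an invertible linear operator $T_g$ on $\mathcal{S}$,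 unique up to a scalar, with $\rho_\psi(h)\circ T_g=T_g\circ\rho_\psi(h\cdot g)$ for all $h\in\mathcal{H}$. Let $P\subset \mathrm{Sp}_{2d}(\mathbb{Q}_p)$ be the Siegel parabolic subgroup of matrices whose lower left $d\times d$ block is zero. For $\alpha=Pg\in P\backslash \mathrm{Sp}_{2d}(\mathbb{Q}_p)$ let $\|\cdot\|_\alpha$ be the norm on $\mathcal{S}$ which is proportional to $f\mapsto\sup_{x\in\mathbb{Q}_p^d}|T_g(f)(x)|_p$ and takes the value $1$ at the characteristic function of $\mathbb{Z}_p^d$; it depends only on $\alpha$ and is $\mathcal{H}$-invariant. Let $\widehat{\mathcal{S}}_\alpha$ be the completion of $\mathcal{S}$ with respect to $\|\cdot\|_\alpha$, with the induced action of $\mathcal{H}$. A Banach representation of $\mathcal{H}$ is a pair $(B,\|\cdot\|)$ of a $\mathbb{C}_p$-linear representation $B$ of the abstract group $\mathcal{H}$ and an $\mathcal{H}$-invariant non-archimedean norm $\|\cdot\|$ for which $B$ is complete; it is topologically irreducible if $B\neq0$ and its only closed subrepresentations are $0$ and $B$. **Theorem.** Let $\alpha\in P\backslash \mathrm{Sp}_{2d}(\mathbb{Q}_p)$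 and let $(B,\|\cdot\|)$ be a topologically irreducible Banach representation of $\mathcal{H}$. Let $F$ be either 1. a non-zero continuous $\mathcal{H}$-equivariant $\mathbb{C}_p$-linear map $F:B\to\widehat{\mathcal{S}}_\alpha$, or 2. a non-zero continuous $\mathcal{H}$-equivariant $\mathbb{C}_p$-linear map $F:\widehat{\mathcal{S}}_\alpha\to B$. Then $F$ is an isomorphism of Banach representations, that is, it is bijective with continuous inverse. Moreover, there exists $r>0$ such that, after replacing $\|\cdot\|$ by $r\cdot\|\cdot\|$, $F$ becomes an isometric isomorphism. -/

import Mathlib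

namespace PadicHeis

open Matrix

noncomputable section

/-- A nontrivial smooth character `ψ : (ℚ_p, +) → ℂ_pˣ`. -/
structure SmoothChar (p : ℕ) [Fact p.Prime] where
  toAddChar : AddChar ℚ_[p] ℂ_[p]
  isOpen_ker : IsOpen {x : ℚ_[p] | toAddChar x = 1}
  nontrivial : ∃ x : ℚ_[p], toAddChar x ≠ 1

/-- The symplectic form on `W = ℚ_p^d ⊕ ℚ_p^d`. -/
def symp {p : ℕ} [Fact p.Prime] {d : ℕ} (v w : Fin d ⊕ Fin d → ℚ_[p]) : ℚ_[p] :=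
  (v ∘ Sum.inl) ⬝ᵥ (w ∘ Sum.inr) - (v ∘ Sum.inr) ⬝ᵥ (w ∘ Sum.inl)

/-- The underlying set of the Heisenberg group: pairs `[w, t]`. -/
@[ext] structure Heis (p : ℕ) [Fact p.Prime] (d : ℕ) where
  w : Fin d ⊕ Fin d → ℚ_[p]
  t : ℚ_[p]

section Basic

variable {p : ℕ} [Fact p.Prime] {d : ℕ}

theorem symp_add_left (u v w : Fin d ⊕ Fin d → ℚ_[p]) :
    symp (u + v) w = symp u w + symp v w := by
  have h1 : (u + v) ∘ Sum.inl = u ∘ Sum.inl + v ∘ Sum.inl := rfl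
  have h2 : (u + v) ∘ Sum.inr = u ∘ Sum.inr + v ∘ Sum.inr := rfl
  simp only [symp, h1, h2, add_dotProduct]; ring

theorem symp_swap (u v : Fin d ⊕ Fin d → ℚ_[p]) : symp u v = -symp v u := by
  simp only [symp]
  rw [dotProduct_comm (u ∘ Sum.inl), dotProduct_comm (u ∘ Sum.inr)]; ring

theorem symp_self (u : Fin d ⊕ Fin d → ℚ_[p]) : symp u u = 0 := by
  simp only [symp]; rw [dotProduct_comm (u ∘ Sum.inl), sub_self]

theorem symp_add_right (u v w : Fin d ⊕ Fin d → ℚ_[p]) :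
    symp u (v + w) = symp u v + symp u w := by
  rw [symp_swap, symp_add_left, symp_swap v, symp_swap w]; ring

theorem symp_neg_left (u v : Fin d ⊕ Fin d → ℚ_[p]) : symp (-u) v = -symp u v := by
  have h := symp_add_left u (-u) v
  have h0 : symp (0 : Fin d ⊕ Fin d → ℚ_[p]) v = 0 := by simpa using symp_add_left 0 0 v
  rw [add_neg_cancel, h0] at h
  linear_combination -h

theorem symp_zero_left (v : Fin d ⊕ Fin d → ℚ_[p]) : symp 0 v = 0 := by
  simpa using symp_add_left 0 0 v

theorem symp_zero_right (v : Fin d ⊕ Fin d → ℚ_[p]) : symp v 0 = 0 := by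
  simpa using symp_add_right v 0 0

/-- The group law `[w₁, t₁] [w₂, t₂] = [w₁ + w₂, t₁ + t₂ + ω(w₁, w₂) / 2]`. -/
instance : Group (Heis p d) where
  mul g h := ⟨g.w + h.w, g.t + h.t + symp g.w h.w / 2⟩
  one := ⟨0, 0⟩
  inv g := ⟨-g.w, -g.t⟩
  mul_assoc a b c := by
    apply Heis.ext
    · exact add_assoc a.w b.w c.w
    · change a.t + b.t + symp a.w b.w / 2 + c.t + symp (a.w + b.w) c.w / 2 =
        a.t + (b.t + c.t + symp b.w c.w / 2) + symp a.w (b.w + c.w) / 2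
      rw [symp_add_left, symp_add_right]; ring
  one_mul a := by
    apply Heis.ext
    · exact zero_add a.w
    · change 0 + a.t + symp 0 a.w / 2 = a.t
      rw [symp_zero_left]; ring
  mul_one a := by
    apply Heis.ext
    · exact add_zero a.w
    · change a.t + 0 + symp a.w 0 / 2 = a.t
      rw [symp_zero_right]; ring
  inv_mul_cancel a := by
    apply Heis.ext
    · exact neg_add_cancel a.w
    · change -a.t + a.t + symp (-a.w) a.w / 2 = 0
      rw [symp_neg_left, symp_self]; ring

@[simp] theorem mul_w (g h : Heis p d) : (g * h).w = g.w + h.w := rfl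
@[simp] theorem mul_t (g h : Heis p d) : (g * h).t = g.t + h.t + symp g.w h.w / 2 := rfl
@[simp] theorem one_w : (1 : Heis p d).w = 0 := rfl
@[simp] theorem one_t : (1 : Heis p d).t = 0 := rfl

theorem symp_vecMul (g : symplecticGroup (Fin d) ℚ_[p]) (v w : Fin d ⊕ Fin d → ℚ_[p]) :
    symp (v ᵥ* g.1) (w ᵥ* g.1) = symp v w := by
  have key : ∀ v w : Fin d ⊕ Fin d → ℚ_[p], symp v w = -(v ⬝ᵥ J (Fin d) ℚ_[p] *ᵥ w) := by
    intro v w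
    simp [symp, J, dotProduct, Fintype.sum_sum_type, mulVec, fromBlocks, Matrix.one_apply]
    ring
  rw [key, key, ← mulVec_transpose g.1 w, mulVec_mulVec, ← dotProduct_mulVec, mulVec_mulVec,
    ← Matrix.mul_assoc, SymplecticGroup.mem_iff.mp g.2]

/-- The right action of the symplectic group by automorphisms: `[w, t] ↦ [w g, t]`
(`w` is a row vector). -/
def Heis.act (g : symplecticGroup (Fin d) ℚ_[p]) : Heis p d →* Heis p d where
  toFun h := ⟨h.w ᵥ* g.1, h.t⟩
  map_one' := by
    apply Heis.ext
    · exact zero_vecMul g.1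
    · rfl
  map_mul' a b := by
    apply Heis.ext
    · exact add_vecMul g.1 a.w b.w
    · simp [symp_vecMul]

/-- The space `𝒮(ℚ_p^d)` of locally constant compactly supported `ℂ_p`-valued functions. -/
def Schw (p : ℕ) [Fact p.Prime] (d : ℕ) : Submodule ℂ_[p] ((Fin d → ℚ_[p]) → ℂ_[p]) where
  carrier := {f | IsLocallyConstant f ∧ HasCompactSupport f}
  add_mem' {_ _} hf hg := ⟨hf.1.comp₂ hg.1 (· + ·), hf.2.add hg.2⟩
  zero_mem' := ⟨IsLocallyConstant.const 0, HasCompactSupport.zero⟩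
  smul_mem' c _ hf := ⟨hf.1.comp (c • ·), hf.2.comp_left (g := (c • ·)) (smul_zero c)⟩

theorem SmoothChar.isLocallyConstant (ψ : SmoothChar p) : IsLocallyConstant ψ.toAddChar := by
  rw [IsLocallyConstant.iff_eventually_eq]
  intro x
  have h0 : {x : ℚ_[p] | ψ.toAddChar x = 1} ∈ nhds (0 : ℚ_[p]) :=
    ψ.isOpen_ker.mem_nhds (by simp)
  have ht : Filter.Tendsto (fun y : ℚ_[p] => y - x) (nhds x) (nhds 0) := by
    have : Continuous fun y : ℚ_[p] => y - x := by fun_prop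
    simpa using this.tendsto x
  filter_upwards [ht h0] with y hy
  have hy' : ψ.toAddChar (y - x) = 1 := hy
  calc ψ.toAddChar y = ψ.toAddChar ((y - x) + x) := by rw [sub_add_cancel]
    _ = ψ.toAddChar x := by rw [AddChar.map_add_eq_mul, hy', one_mul]

theorem schrodinger_mem (ψ : SmoothChar p) (h : Heis p d) (f : Schw p d) :
    (fun x : Fin d → ℚ_[p] =>
      ψ.toAddChar (h.t + (h.w ∘ Sum.inl) ⬝ᵥ (h.w ∘ Sum.inr) / 2 + (h.w ∘ Sum.inr) ⬝ᵥ x) *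
        f.1 (x + h.w ∘ Sum.inl)) ∈ Schw p d := by
  constructor
  · have hc : Continuous fun x : Fin d → ℚ_[p] =>
        h.t + (h.w ∘ Sum.inl) ⬝ᵥ (h.w ∘ Sum.inr) / 2 + (h.w ∘ Sum.inr) ⬝ᵥ x := by
      unfold dotProduct; fun_prop
    have hc' : Continuous fun x : Fin d → ℚ_[p] => x + h.w ∘ Sum.inl := by fun_prop
    exact (ψ.isLocallyConstant.comp_continuous hc).mul (f.2.1.comp_continuous hc')
  · exact HasCompactSupport.mul_left
      (f.2.2.comp_homeomorph (Homeomorph.addRight (h.w ∘ Sum.inl)))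

/-- The Schrödinger representation: for `h = [(a, b), t]`,
`(ρ_ψ(h) f)(x) = ψ(t + a·b/2 + b·x) f(x + a)`. -/
def schrodinger (ψ : SmoothChar p) (d : ℕ) : Representation ℂ_[p] (Heis p d) (Schw p d) where
  toFun h :=
    { toFun := fun f => ⟨_, schrodinger_mem ψ h f⟩
      map_add' := fun f g => by
        ext x; simp [mul_add]
      map_smul' := fun c f => by
        ext x; simp [mul_left_comm] }
  map_one' := by
    ext f x
    have h1 : (0 : Fin d ⊕ Fin d → ℚ_[p]) ∘ Sum.inl = 0 := rfl
    have h2 : (0 : Fin d ⊕ Fin d → ℚ_[p]) ∘ Sum.inr = 0 := rfl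
    simp [h1, h2]
  map_mul' g h := by
    ext f x
    have h1 : (g.w + h.w) ∘ Sum.inl = g.w ∘ Sum.inl + h.w ∘ Sum.inl := rfl
    have h2 : (g.w + h.w) ∘ Sum.inr = g.w ∘ Sum.inr + h.w ∘ Sum.inr := rfl
    simp only [mul_w, mul_t, h1, h2, LinearMap.coe_mk, AddHom.coe_mk, Module.End.mul_apply]
    rw [← mul_assoc, ← AddChar.map_add_eq_mul, add_assoc x]
    congr 2
    simp only [symp, add_dotProduct, dotProduct_add]
    rw [dotProduct_comm (h.w ∘ Sum.inl) (g.w ∘ Sum.inr),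
      dotProduct_comm (h.w ∘ Sum.inr) (g.w ∘ Sum.inl)]
    ring

theorem schrodinger_apply (ψ : SmoothChar p) (h : Heis p d) (f : Schw p d)
    (x : Fin d → ℚ_[p]) : (schrodinger ψ d h f).1 x =
      ψ.toAddChar (h.t + (h.w ∘ Sum.inl) ⬝ᵥ (h.w ∘ Sum.inr) / 2 + (h.w ∘ Sum.inr) ⬝ᵥ x) *
        f.1 (x + h.w ∘ Sum.inl) := rfl

end Basic
section Irreducibility

variable {p : ℕ} [Fact p.Prime] {d : ℕ}

theorem SmoothChar.ne_zero (ψ : SmoothChar p) (x : ℚ_[p]) : ψ.toAddChar x ≠ 0 := by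
  intro h
  have h1 : ψ.toAddChar (x + -x) = 0 := by rw [AddChar.map_add_eq_mul, h, zero_mul]
  rw [add_neg_cancel, AddChar.map_zero_eq_one] at h1
  exact one_ne_zero h1

theorem SmoothChar.norm_eq_one (ψ : SmoothChar p) (x : ℚ_[p]) : ‖ψ.toAddChar x‖ = 1 := by
  have hp1 : (1 : ℝ) < p := by exact_mod_cast (Fact.out : p.Prime).one_lt
  obtain ⟨ε, hε, hball⟩ := Metric.isOpen_iff.mp ψ.isOpen_ker 0 (by simp)
  obtain ⟨n, hn⟩ := exists_pow_lt_of_lt_one (y := ((p : ℝ)⁻¹))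
    (div_pos hε (show 0 < ‖x‖ + 1 by positivity)) (inv_lt_one_of_one_lt₀ hp1)
  have h1 : ψ.toAddChar ((p ^ n : ℕ) • x) = 1 := by
    apply hball
    rw [mem_ball_zero_iff, nsmul_eq_mul, norm_mul]
    push_cast
    rw [norm_pow, Padic.norm_p]
    rw [lt_div_iff₀ (by positivity)] at hn
    refine lt_of_le_of_lt ?_ hn
    gcongr
    linarith
  rw [AddChar.map_nsmul_eq_pow] at h1
  have h2 := congrArg norm h1
  rw [norm_pow, norm_one] at h2
  exact (pow_eq_one_iff_of_nonneg (norm_nonneg _)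
    (pow_pos (Fact.out : p.Prime).pos n).ne').mp h2

theorem exists_sep (ψ : SmoothChar p) {z : ℚ_[p]} (hz : z ≠ 0) :
    ∃ s : ℚ_[p], ψ.toAddChar (s * z) ≠ 1 ∧ ∀ y, ‖y‖ < ‖z‖ → ψ.toAddChar (s * y) = 1 := by
  classical
  obtain ⟨x, hx⟩ := ψ.nontrivial
  have hp1 : (1 : ℝ) < p := by exact_mod_cast (Fact.out : p.Prime).one_lt
  have hp0 : (0 : ℝ) < p := by linarith
  have hx0 : 0 < ‖x‖ := by
    rw [norm_pos_iff]; rintro rfl; simp at hx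
  have hex : ∃ n : ℕ, ∀ y : ℚ_[p], ‖y‖ ≤ ‖x‖ * ((p : ℝ)⁻¹) ^ n → ψ.toAddChar y = 1 := by
    obtain ⟨ε, hε, hball⟩ := Metric.isOpen_iff.mp ψ.isOpen_ker 0 (by simp)
    obtain ⟨n, hn⟩ := exists_pow_lt_of_lt_one (div_pos hε hx0) (inv_lt_one_of_one_lt₀ hp1)
    refine ⟨n, fun y hy => hball ?_⟩
    rw [mem_ball_zero_iff]
    refine hy.trans_lt ?_
    rwa [lt_div_iff₀ hx0, mul_comm] at hn
  obtain ⟨m, hm⟩ : ∃ m, Nat.find hex = m + 1 := by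
    refine Nat.exists_eq_succ_of_ne_zero fun h0 => hx ?_
    have := Nat.find_spec hex
    rw [h0] at this
    exact this x (by simp)
  have h1 := Nat.find_min hex (m := m) (by omega)
  have h2 := Nat.find_spec hex
  rw [hm] at h2
  push Not at h1
  obtain ⟨r, hr, hr1⟩ := h1
  have hr0 : r ≠ 0 := by rintro rfl; simp at hr1
  refine ⟨r / z, by rwa [div_mul_cancel₀ _ hz], fun y hy => h2 _ ?_⟩
  have hq : ‖y / z‖ ≤ (p : ℝ) ^ (-1 : ℤ) := by
    rw [Padic.norm_le_pow_iff_norm_lt_pow_add_one]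
    simp only [neg_add_cancel, zpow_zero, norm_div]
    rwa [div_lt_one (norm_pos_iff.mpr hz)]
  calc ‖r / z * y‖ = ‖r‖ * ‖y / z‖ := by
        rw [← norm_mul]; congr 1; ring
    _ ≤ (‖x‖ * ((p : ℝ)⁻¹) ^ m) * (p : ℝ)⁻¹ := by
        rw [_root_.zpow_neg_one] at hq
        gcongr
    _ = _ := by ring

theorem norm_dot_le (a b : Fin d → ℚ_[p]) : ‖a ⬝ᵥ b‖ ≤ ‖a‖ * ‖b‖ := by
  refine IsUltrametricDist.norm_sum_le_of_forall_le_of_nonneg (by positivity) fun i _ => ?_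
  rw [norm_mul]
  exact mul_le_mul (norm_le_pi_norm a i) (norm_le_pi_norm b i) (by positivity) (by positivity)

theorem exists_sep_vec (ψ : SmoothChar p) {z : Fin d → ℚ_[p]} {ε : ℝ} (hε : 0 < ε)
    (hz : ε ≤ ‖z‖) : ∃ b : Fin d → ℚ_[p], ψ.toAddChar (b ⬝ᵥ z) ≠ 1 ∧
      ∀ y : Fin d → ℚ_[p], ‖y‖ < ε → ψ.toAddChar (b ⬝ᵥ y) = 1 := by
  obtain ⟨i, hi⟩ : ∃ i, ε ≤ ‖z i‖ := by
    by_contra! h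
    exact absurd ((pi_norm_lt_iff hε).mpr h) (not_lt.mpr hz)
  have hzi : z i ≠ 0 := by
    rw [← norm_pos_iff]; linarith
  obtain ⟨s, hs, hs'⟩ := exists_sep ψ hzi
  refine ⟨Pi.single i s, by simpa using hs, fun y hy => ?_⟩
  rw [single_dotProduct]
  exact hs' _ (lt_of_lt_of_le ((norm_le_pi_norm y i).trans_lt hy) hi)

theorem exists_invariant (f : Schw p d) :
    ∃ ε > 0, ∀ x y : Fin d → ℚ_[p], ‖y‖ < ε → f.1 (x + y) = f.1 x := by
  obtain ⟨δ, hδ, h⟩ := lebesgue_number_lemma_of_metric (s := tsupport f.1)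
    (c := fun c : ℂ_[p] => f.1 ⁻¹' {c}) f.2.2 (fun c => f.2.1.isOpen_fiber c)
    (fun x _ => Set.mem_iUnion.mpr ⟨f.1 x, rfl⟩)
  have key : ∀ x y, x ∈ tsupport f.1 → dist y x < δ → f.1 y = f.1 x := by
    intro x y hx hy
    obtain ⟨c, hc⟩ := h x hx
    have h1 : f.1 y = c := hc hy
    have h2 : f.1 x = c := hc (Metric.mem_ball_self hδ)
    rw [h1, h2]
  refine ⟨δ, hδ, fun x y hy => ?_⟩
  by_cases hx : x ∈ tsupport f.1
  · exact key x _ hx (by simpa [dist_eq_norm] using hy)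
  by_cases hxy : x + y ∈ tsupport f.1
  · exact (key _ x hxy (by simpa [dist_eq_norm] using hy)).symm
  · rw [image_eq_zero_of_notMem_tsupport hx, image_eq_zero_of_notMem_tsupport hxy]

/-- The characteristic function of a compact open set, as an element of `𝒮(ℚ_p^d)`. -/
def charFn (U : Set (Fin d → ℚ_[p])) (hU : IsClopen U) (hc : IsCompact U) : Schw p d :=
  ⟨U.indicator 1, by
    refine ⟨?_, HasCompactSupport.intro hc fun x hx => Set.indicator_of_notMem hx _⟩
    rw [IsLocallyConstant.iff_eventually_eq]
    intro x
    by_cases hx : x ∈ U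
    · filter_upwards [hU.isOpen.mem_nhds hx] with y hy
      rw [Set.indicator_of_mem hy, Set.indicator_of_mem hx]; rfl
    · filter_upwards [hU.compl.isOpen.mem_nhds hx] with y hy
      rw [Set.indicator_of_notMem hy, Set.indicator_of_notMem hx]⟩

theorem isCompact_ball (c : Fin d → ℚ_[p]) (ε : ℝ) : IsCompact (Metric.ball c ε) :=
  (isCompact_closedBall c ε).of_isClosed_subset
    (IsUltrametricDist.isClopen_ball c ε).isClosed Metric.ball_subset_closedBall

/-- The characteristic function of an open ball. -/
def ballFn (c : Fin d → ℚ_[p]) (ε : ℝ) : Schw p d :=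
  charFn (Metric.ball c ε) (IsUltrametricDist.isClopen_ball c ε) (isCompact_ball c ε)

theorem ballFn_of_mem {c x : Fin d → ℚ_[p]} {ε : ℝ} (h : ‖x - c‖ < ε) : (ballFn c ε).1 x = 1 := by
  change Set.indicator _ _ _ = _
  rw [Set.indicator_of_mem (by rwa [Metric.mem_ball, dist_eq_norm])]; rfl

theorem ballFn_of_notMem {c x : Fin d → ℚ_[p]} {ε : ℝ} (h : ¬ ‖x - c‖ < ε) :
    (ballFn c ε).1 x = 0 := by
  change Set.indicator _ _ _ = _
  rw [Set.indicator_of_notMem (by rwa [Metric.mem_ball, dist_eq_norm])]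

theorem norm_sub_lt_trans {x y z : Fin d → ℚ_[p]} {ε : ℝ} (h1 : ‖x - y‖ < ε) (h2 : ‖y - z‖ < ε) :
    ‖x - z‖ < ε := by
  rw [← sub_add_sub_cancel x y z]
  exact (IsUltrametricDist.norm_add_le_max _ _).trans_lt (max_lt h1 h2)

theorem exists_cover (f : Schw p d) {ε : ℝ} (hε : 0 < ε) :
    ∃ s : Finset (Fin d → ℚ_[p]), ∀ x, f.1 x ≠ 0 → ∃ c ∈ s, ‖x - c‖ < ε := by
  obtain ⟨t, ht⟩ := f.2.2.isCompact.elim_finite_subcover (fun c => Metric.ball c ε)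
    (fun c => Metric.isOpen_ball) (fun x _ => Set.mem_iUnion.mpr ⟨x, Metric.mem_ball_self hε⟩)
  refine ⟨t, fun x hx => ?_⟩
  have := ht (subset_tsupport _ hx)
  simp only [Set.mem_iUnion, Metric.mem_ball, dist_eq_norm] at this
  obtain ⟨c, hc, h⟩ := this
  exact ⟨c, hc, h⟩

/-- The group element `[(a, 0), 0]`. -/
def transl (a : Fin d → ℚ_[p]) : Heis p d := ⟨Sum.elim a 0, 0⟩

/-- The group element `[(0, b), 0]`. -/
def modul (b : Fin d → ℚ_[p]) : Heis p d := ⟨Sum.elim 0 b, 0⟩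

theorem schrodinger_transl (ψ : SmoothChar p) (a : Fin d → ℚ_[p]) (f : Schw p d)
    (x : Fin d → ℚ_[p]) : (schrodinger ψ d (transl a) f).1 x = f.1 (x + a) := by
  rw [schrodinger_apply]; simp [transl]

theorem schrodinger_modul (ψ : SmoothChar p) (b : Fin d → ℚ_[p]) (f : Schw p d)
    (x : Fin d → ℚ_[p]) :
    (schrodinger ψ d (modul b) f).1 x = ψ.toAddChar (b ⬝ᵥ x) * f.1 x := by
  rw [schrodinger_apply]; simp [modul]

theorem mem_span_balls (W : Submodule ℂ_[p] (Schw p d)) {ε : ℝ}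
    (hW : ∀ c, ballFn c ε ∈ W) (s : Finset (Fin d → ℚ_[p])) : ∀ f : Schw p d,
    (∀ x y, ‖y‖ < ε → f.1 (x + y) = f.1 x) → (∀ x, f.1 x ≠ 0 → ∃ c ∈ s, ‖x - c‖ < ε) →
    f ∈ W := by
  classical
  induction s using Finset.induction_on with
  | empty =>
    intro f _ hs
    have : f = 0 := by
      ext x
      by_contra h
      obtain ⟨c, hc, _⟩ := hs x h
      simp at hc
    rw [this]; exact W.zero_mem
  | insert c s hc ih =>
    intro f hf hs
    have hsub : f - f.1 c • ballFn c ε ∈ W := by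
      apply ih
      · intro x y hy
        change f.1 (x + y) - f.1 c * (ballFn c ε).1 (x + y) = f.1 x - f.1 c * (ballFn c ε).1 x
        rw [hf x y hy]
        by_cases h : ‖x - c‖ < ε
        · rw [ballFn_of_mem h, ballFn_of_mem (norm_sub_lt_trans (y := x) (by simpa using hy) h)]
        · rw [ballFn_of_notMem h, ballFn_of_notMem fun h' =>
            h (norm_sub_lt_trans (y := x + y) (by simpa using hy) h')]
      · intro x hx
        change f.1 x - f.1 c * (ballFn c ε).1 x ≠ 0 at hx
        by_cases h : ‖x - c‖ < ε
        · have := hf c (x - c) h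
          rw [add_sub_cancel] at this
          rw [ballFn_of_mem h, this] at hx
          simp at hx
        · rw [ballFn_of_notMem h] at hx
          obtain ⟨c', hc', h'⟩ := hs x (by simpa using hx)
          rcases Finset.mem_insert.mp hc' with rfl | hmem
          · exact absurd h' h
          · exact ⟨c', hmem, h'⟩
    have := W.add_mem hsub (W.smul_mem (f.1 c) (hW c))
    simpa using this

theorem exists_ballFn_mem (ψ : SmoothChar p) (W : Submodule ℂ_[p] (Schw p d))
    (hW : ∀ h f, f ∈ W → schrodinger ψ d h f ∈ W) {ε : ℝ} (hε : 0 < ε) (n : ℕ) :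
    ∀ (s : Finset (Fin d → ℚ_[p])) (f : Schw p d), s.card ≤ n → f ∈ W → f ≠ 0 →
    (∀ x y, ‖y‖ < ε → f.1 (x + y) = f.1 x) → (∀ x, f.1 x ≠ 0 → ∃ c ∈ s, ‖x - c‖ < ε) →
    ∃ c, ballFn c ε ∈ W := by
  classical
  induction n with
  | zero =>
    intro s f hn _ hf0 _ hs
    refine absurd ?_ hf0
    ext x
    by_contra h
    obtain ⟨c, hc, _⟩ := hs x h
    simp [Finset.card_eq_zero.mp (Nat.le_zero.mp hn)] at hc
  | succ n ih =>
    intro s f hn hfW hf0 hf hs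
    obtain ⟨x₀, hx₀⟩ : ∃ x, f.1 x ≠ 0 := by
      by_contra! h
      exact hf0 (by ext x; exact h x)
    by_cases hsupp : ∀ x, f.1 x ≠ 0 → ‖x - x₀‖ < ε
    · refine ⟨x₀, ?_⟩
      have hfe : f = f.1 x₀ • ballFn x₀ ε := by
        ext x
        change f.1 x = f.1 x₀ * (ballFn x₀ ε).1 x
        by_cases h : ‖x - x₀‖ < ε
        · have := hf x₀ (x - x₀) h
          rw [add_sub_cancel] at this
          rw [ballFn_of_mem h, this, mul_one]
        · rw [ballFn_of_notMem h, mul_zero]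
          by_contra h'
          exact h (hsupp x h')
      have := W.smul_mem (f.1 x₀)⁻¹ hfW
      rw [hfe, smul_smul] at this
      rw [hfe] at hx₀
      have hx' : f.1 x₀ ≠ 0 := fun h => hx₀ (by
        change f.1 x₀ * _ = 0
        rw [h, zero_mul])
      convert this using 1
      rw [← hfe, inv_mul_cancel₀ hx', one_smul]
    · push Not at hsupp
      obtain ⟨x₁, hx₁, hfar⟩ := hsupp
      obtain ⟨b, hb, hb'⟩ := exists_sep_vec ψ hε hfar
      have hsplit : ∀ x y : Fin d → ℚ_[p], ‖y‖ < ε →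
          ψ.toAddChar (b ⬝ᵥ (x + y)) = ψ.toAddChar (b ⬝ᵥ x) := by
        intro x y hy
        rw [dotProduct_add, AddChar.map_add_eq_mul, hb' y hy, mul_one]
      set g : Schw p d := schrodinger ψ d (modul b) f - ψ.toAddChar (b ⬝ᵥ x₀) • f with hg
      have hgx : ∀ x, g.1 x = (ψ.toAddChar (b ⬝ᵥ x) - ψ.toAddChar (b ⬝ᵥ x₀)) * f.1 x := by
        intro x
        have : g.1 x = (schrodinger ψ d (modul b) f).1 x - ψ.toAddChar (b ⬝ᵥ x₀) * f.1 x := rfl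
        rw [this, schrodinger_modul, sub_mul]
      obtain ⟨c₀, hc₀, hxc₀⟩ := hs x₀ hx₀
      refine ih (s.erase c₀) g ?_ (W.sub_mem (hW _ _ hfW) (W.smul_mem _ hfW)) ?_ ?_ ?_
      · rw [Finset.card_erase_of_mem hc₀]; omega
      · intro h0
        have h1 : g.1 x₁ = 0 := by rw [h0]; rfl
        rw [hgx] at h1
        rcases mul_eq_zero.mp h1 with h | h
        · apply hb
          rw [sub_eq_zero] at h
          rw [dotProduct_sub, AddChar.map_sub_eq_div, h, div_self]
          exact ψ.ne_zero _
        · exact hx₁ h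
      · intro x y hy
        rw [hgx, hgx, hsplit x y hy, hf x y hy]
      · intro x hx
        rw [hgx] at hx
        obtain ⟨c, hc, hxc⟩ := hs x (right_ne_zero_of_mul hx)
        refine ⟨c, Finset.mem_erase.mpr ⟨?_, hc⟩, hxc⟩
        rintro rfl
        have h3 : ‖x - x₀‖ < ε := norm_sub_lt_trans hxc (by rwa [norm_sub_rev])
        have h4 := hsplit x₀ (x - x₀) h3
        rw [add_sub_cancel] at h4
        rw [h4, sub_self, zero_mul] at hx
        exact hx rfl

/-- The Schrödinger representation is (algebraically) irreducible. -/
theorem schrodinger_irreducible (ψ : SmoothChar p) (W : Submodule ℂ_[p] (Schw p d))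
    (hW : ∀ h f, f ∈ W → schrodinger ψ d h f ∈ W) (hne : W ≠ ⊥) : W = ⊤ := by
  obtain ⟨f, hfW, hf0⟩ := W.exists_mem_ne_zero_of_ne_bot hne
  obtain ⟨ε₁, hε₁, hf⟩ := exists_invariant f
  rw [eq_top_iff]
  rintro g -
  obtain ⟨ε₂, hε₂, hg⟩ := exists_invariant g
  have hε : 0 < min ε₁ ε₂ := lt_min hε₁ hε₂
  obtain ⟨s, hs⟩ := exists_cover f hε
  obtain ⟨c, hc⟩ := exists_ballFn_mem ψ W hW hε s.card s f le_rfl hfW hf0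
    (fun x y hy => hf x y (hy.trans_le (min_le_left _ _))) hs
  obtain ⟨t, ht⟩ := exists_cover g hε
  refine mem_span_balls W (fun c' => ?_) t g
    (fun x y hy => hg x y (hy.trans_le (min_le_right _ _))) ht
  have h1 := hW (transl (c - c')) _ hc
  convert h1 using 1
  ext x
  rw [schrodinger_transl]
  have hxx : x + (c - c') - c = x - c' := by abel
  by_cases h : ‖x - c'‖ < min ε₁ ε₂
  · rw [ballFn_of_mem h, ballFn_of_mem (by rwa [hxx])]
  · rw [ballFn_of_notMem h, ballFn_of_notMem (by rwa [hxx])]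

end Irreducibility

section Intertwiner

variable {p : ℕ} [Fact p.Prime] {d : ℕ}

/-- `T` is an intertwining operator attached to `g`:
`ρ_ψ([w, t]) ∘ T = T ∘ ρ_ψ([w g, t])` for all `[w, t]`. -/
def IsIntertwiner (ψ : SmoothChar p) (g : symplecticGroup (Fin d) ℚ_[p])
    (T : Schw p d ≃ₗ[ℂ_[p]] Schw p d) : Prop :=
  ∀ (h : Heis p d) (f : Schw p d),
    schrodinger ψ d h (T f) = T (schrodinger ψ d (Heis.act g h) f)

theorem exists_fixing (ψ : SmoothChar p) (f : Schw p d) :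
    ∃ ε > 0, ∀ h : Heis p d, h.t = 0 → ‖h.w‖ < ε → schrodinger ψ d h f = f := by
  obtain ⟨δ, hδ, hf⟩ := exists_invariant f
  obtain ⟨r, hr, hball⟩ := Metric.isOpen_iff.mp ψ.isOpen_ker 0 (by simp)
  obtain ⟨R, hR⟩ := f.2.2.isCompact.isBounded.exists_norm_le
  set M : ℝ := max R 0 + ‖(2 : ℚ_[p])⁻¹‖ + 1 with hM
  have hM0 : 0 < M := by positivity
  refine ⟨min (min δ 1) (r / M), by positivity, fun h ht hw => ?_⟩
  have hw1 : ‖h.w‖ < δ := hw.trans_le ((min_le_left _ _).trans (min_le_left _ _))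
  have hw2 : ‖h.w‖ < 1 := hw.trans_le ((min_le_left _ _).trans (min_le_right _ _))
  have hw3 : ‖h.w‖ * M < r := by
    rw [← lt_div_iff₀ hM0]; exact hw.trans_le (min_le_right _ _)
  have ha : ‖h.w ∘ Sum.inl‖ ≤ ‖h.w‖ :=
    (pi_norm_le_iff_of_nonneg (norm_nonneg _)).mpr fun i => norm_le_pi_norm h.w _
  have hb : ‖h.w ∘ Sum.inr‖ ≤ ‖h.w‖ :=
    (pi_norm_le_iff_of_nonneg (norm_nonneg _)).mpr fun i => norm_le_pi_norm h.w _
  ext x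
  rw [schrodinger_apply, hf x _ (ha.trans_lt hw1), ht, zero_add]
  by_cases hx : f.1 x = 0
  · rw [hx, mul_zero]
  have hxR : ‖x‖ ≤ max R 0 := (hR x (subset_tsupport _ hx)).trans (le_max_left _ _)
  have : ψ.toAddChar ((h.w ∘ Sum.inl) ⬝ᵥ (h.w ∘ Sum.inr) / 2 + (h.w ∘ Sum.inr) ⬝ᵥ x) = 1 := by
    apply hball
    rw [mem_ball_zero_iff]
    refine lt_of_le_of_lt ?_ hw3
    refine (norm_add_le _ _).trans ?_
    rw [div_eq_mul_inv, norm_mul]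
    have e1 : ‖(h.w ∘ Sum.inl) ⬝ᵥ (h.w ∘ Sum.inr)‖ ≤ ‖h.w‖ * 1 :=
      (norm_dot_le _ _).trans (mul_le_mul ha (hb.trans hw2.le) (norm_nonneg _) (norm_nonneg _))
    have e2 : ‖(h.w ∘ Sum.inr) ⬝ᵥ x‖ ≤ ‖h.w‖ * max R 0 :=
      (norm_dot_le _ _).trans (mul_le_mul hb hxR (norm_nonneg _) (norm_nonneg _))
    have e3 := mul_le_mul_of_nonneg_right e1 (norm_nonneg (2 : ℚ_[p])⁻¹)
    have e4 := norm_nonneg h.w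
    rw [hM]
    linarith
  rw [this, one_mul]

/-- The symplectic group preserves the form, on the Lagrangian `{(b C, b D)}`. -/
theorem lagr_symm (g : symplecticGroup (Fin d) ℚ_[p]) (b b' : Fin d → ℚ_[p]) :
    (b ᵥ* g.1.toBlocks₂₁) ⬝ᵥ (b' ᵥ* g.1.toBlocks₂₂) =
      (b ᵥ* g.1.toBlocks₂₂) ⬝ᵥ (b' ᵥ* g.1.toBlocks₂₁) := by
  have h := symp_vecMul g (Sum.elim 0 b) (Sum.elim 0 b')
  have e : ∀ b : Fin d → ℚ_[p], (Sum.elim 0 b : Fin d ⊕ Fin d → ℚ_[p]) ᵥ* g.1 =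
      Sum.elim (b ᵥ* g.1.toBlocks₂₁) (b ᵥ* g.1.toBlocks₂₂) := by
    intro b
    conv_lhs => rw [← fromBlocks_toBlocks g.1]
    rw [vecMul_fromBlocks]; simp
  rw [e, e] at h
  simp only [symp, Sum.elim_comp_inl, Sum.elim_comp_inr, zero_dotProduct, dotProduct_zero,
    sub_zero] at h
  exact sub_eq_zero.mp h

theorem act_modul (g : symplecticGroup (Fin d) ℚ_[p]) (b : Fin d → ℚ_[p]) :
    Heis.act g (modul b) = ⟨Sum.elim (b ᵥ* g.1.toBlocks₂₁) (b ᵥ* g.1.toBlocks₂₂), 0⟩ := by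
  apply Heis.ext
  · change (Sum.elim 0 b : Fin d ⊕ Fin d → ℚ_[p]) ᵥ* g.1 = _
    conv_lhs => rw [← fromBlocks_toBlocks g.1]
    rw [vecMul_fromBlocks]; simp
  · rfl

open MeasureTheory in
/-- A nonzero linear functional on `𝒮(ℚ_p^d)`, invariant under the Lagrangian `(0 × ℚ_p^d) g`. -/
theorem exists_functional (ψ : SmoothChar p) (g : symplecticGroup (Fin d) ℚ_[p]) :
    ∃ ℓ : Schw p d →ₗ[ℂ_[p]] ℂ_[p], ℓ ≠ 0 ∧
      ∀ b f, ℓ (schrodinger ψ d (Heis.act g (modul b)) f) = ℓ f := by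
  set C := g.1.toBlocks₂₁ with hC
  set D := g.1.toBlocks₂₂ with hD
  have hsym : ∀ b b' : Fin d → ℚ_[p],
      (b ᵥ* C) ⬝ᵥ (b' ᵥ* D) = (b ᵥ* D) ⬝ᵥ (b' ᵥ* C) := lagr_symm g
  set U : Submodule ℚ_[p] (Fin d → ℚ_[p]) := LinearMap.range C.vecMulLinear with hU
  obtain ⟨s, hs⟩ := LinearMap.exists_rightInverse_of_surjective C.vecMulLinear.rangeRestrict
    (LinearMap.range_rangeRestrict _)
  have hs' : ∀ u : U, s u ᵥ* C = u.1 := fun u => congrArg Subtype.val (LinearMap.congr_fun hs u)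
  have hsc : Continuous s := s.continuous_of_finiteDimensional
  let Q : U → ℚ_[p] := fun u => u.1 ⬝ᵥ (s u ᵥ* D) / 2
  have hQc : Continuous Q := by
    have h2 : Continuous fun u : U => s u ᵥ* D := by
      have : Continuous fun v : Fin d → ℚ_[p] => v ᵥ* D := by fun_prop
      exact this.comp hsc
    exact (Continuous.dotProduct continuous_subtype_val h2).div_const 2
  have hQ : ∀ (u : U) (b : Fin d → ℚ_[p]) (hb : b ᵥ* C ∈ U),
      Q (u + ⟨b ᵥ* C, hb⟩) = Q u + ((b ᵥ* C) ⬝ᵥ (b ᵥ* D) / 2 + (b ᵥ* D) ⬝ᵥ u.1) := by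
    intro u b hb
    have hb' := hs' ⟨b ᵥ* C, hb⟩
    have h1 : (u + ⟨b ᵥ* C, hb⟩ : U).1 = u.1 + b ᵥ* C := rfl
    simp only [Q, map_add, add_vecMul, h1, add_dotProduct, dotProduct_add]
    set b₁ := s ⟨b ᵥ* C, hb⟩ with hb₁
    have e2 : (b ᵥ* C) ⬝ᵥ (s u ᵥ* D) = (b ᵥ* D) ⬝ᵥ u.1 := by
      rw [hsym, hs' u]
    have e1 : u.1 ⬝ᵥ (b₁ ᵥ* D) = (b ᵥ* D) ⬝ᵥ u.1 := by
      have := hsym (s u) b₁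
      rw [hs' u, hb', dotProduct_comm (s u ᵥ* D), e2] at this
      exact this
    have e3 : (b ᵥ* C) ⬝ᵥ (b₁ ᵥ* D) = (b ᵥ* C) ⬝ᵥ (b ᵥ* D) := by
      rw [hsym, hb', dotProduct_comm]
    rw [e1, e2, e3]
    ring
  let _ : MeasurableSpace U := borel U
  have : BorelSpace U := ⟨rfl⟩
  have : ProperSpace U := FiniteDimensional.proper ℚ_[p] U
  let μ : Measure U := Measure.addHaar
  obtain ⟨φ, hφ⟩ := Module.Projective.exists_dual_ne_zero ℚ (one_ne_zero : (1 : ℂ_[p]) ≠ 0)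
  let R : Schw p d → U → ℂ_[p] := fun f u => ψ.toAddChar (Q u) * f.1 u.1
  have hRl : ∀ f, IsLocallyConstant (R f) := fun f =>
    (ψ.isLocallyConstant.comp_continuous hQc).mul (f.2.1.comp_continuous continuous_subtype_val)
  have hRs : ∀ f, HasCompactSupport (R f) := fun f =>
    HasCompactSupport.mul_left
      (f.2.2.comp_isClosedEmbedding U.closed_of_finiteDimensional.isClosedEmbedding_subtypeVal)
  have hint : ∀ f, Integrable (fun u => ((φ (R f u) : ℚ) : ℝ)) μ := by
    intro f
    refine Continuous.integrable_of_hasCompactSupport ?_ ?_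
    · exact ((hRl f).comp (fun z => ((φ z : ℚ) : ℝ))).continuous
    · exact (hRs f).comp_left (g := fun z => ((φ z : ℚ) : ℝ)) (by simp)
  let I : Schw p d → ℝ := fun f => ∫ u, ((φ (R f u) : ℚ) : ℝ) ∂μ
  have hI : ∀ f f', I (f + f') = I f + I f' := by
    intro f f'
    rw [← integral_add (hint f) (hint f')]
    refine integral_congr_ae (Filter.Eventually.of_forall fun u => ?_)
    have : R (f + f') u = R f u + R f' u := mul_add _ _ _
    simp only [this, map_add]; push_cast; rfl
  have hI0 : I 0 = 0 := by simpa using hI 0 0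
  have hinv : ∀ b f, I (schrodinger ψ d (Heis.act g (modul b)) f) = I f := by
    intro b f
    have hb : b ᵥ* C ∈ U := ⟨b, rfl⟩
    have : ∀ u : U, R (schrodinger ψ d (Heis.act g (modul b)) f) u = R f (u + ⟨b ᵥ* C, hb⟩) := by
      intro u
      simp only [R]
      rw [schrodinger_apply, act_modul, hQ, AddChar.map_add_eq_mul _ (Q u), mul_assoc]
      simp only [Sum.elim_comp_inl, Sum.elim_comp_inr, zero_add]
      rfl
    simp only [I, this]
    exact integral_add_right_eq_self (fun u => ((φ (R f u) : ℚ) : ℝ)) _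
  let S : Submodule ℂ_[p] (Schw p d) := Submodule.span ℂ_[p]
    {v | ∃ b f, v = schrodinger ψ d (Heis.act g (modul b)) f - f}
  have hS : ∀ v ∈ S, ∀ c : ℂ_[p], I (c • v) = 0 := by
    intro v hv
    induction hv using Submodule.span_induction with
    | mem v hv =>
      obtain ⟨b, f, rfl⟩ := hv
      intro c
      have h1 := hI (c • (schrodinger ψ d (Heis.act g (modul b)) f - f)) (c • f)
      rw [← smul_add, sub_add_cancel, ← map_smul, hinv] at h1
      linarith
    | zero => intro c; rw [smul_zero, hI0]
    | add x y _ _ hx hy => intro c; rw [smul_add, hI, hx, hy, add_zero]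
    | smul a x _ hx => intro c; rw [smul_smul, hx]
  obtain ⟨f₀, hf₀⟩ : ∃ f₀, I f₀ ≠ 0 := by
    have h1 : {u : U | ψ.toAddChar (Q u) = 1} ∈ nhds (0 : U) := by
      refine (ψ.isOpen_ker.preimage hQc).mem_nhds ?_
      simp [Q]
    obtain ⟨ε, hε, hball⟩ := Metric.mem_nhds_iff.mp h1
    refine ⟨ballFn 0 ε, ?_⟩
    have h2 : (fun u => ((φ (R (ballFn 0 ε) u) : ℚ) : ℝ)) =
        (Metric.ball (0 : U) ε).indicator fun _ => ((φ 1 : ℚ) : ℝ) := by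
      ext u
      by_cases hu : u ∈ Metric.ball (0 : U) ε
      · have h3 : ψ.toAddChar (Q u) = 1 := hball hu
        have h4 : ‖u.1 - 0‖ < ε := by simpa using hu
        simp only [R]
        rw [Set.indicator_of_mem hu, h3, ballFn_of_mem h4, one_mul]
      · have h4 : ¬ ‖u.1 - 0‖ < ε := by simpa using hu
        simp only [R]
        rw [Set.indicator_of_notMem hu, ballFn_of_notMem h4, mul_zero, map_zero, Rat.cast_zero]
    simp only [I]
    rw [h2, integral_indicator_const _ Metric.isOpen_ball.measurableSet, smul_eq_mul]
    refine mul_ne_zero ?_ (by exact_mod_cast hφ)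
    rw [Measure.real, ENNReal.toReal_ne_zero]
    exact ⟨(Metric.measure_ball_pos μ 0 hε).ne', measure_ball_lt_top.ne⟩
  have hnot : f₀ ∉ S := fun h => hf₀ (by simpa using hS f₀ h 1)
  obtain ⟨ℓ, hℓ, hℓS⟩ := Submodule.exists_le_ker_of_notMem hnot
  refine ⟨ℓ, fun h => hℓ (by rw [h]; rfl), fun b f => ?_⟩
  have := hℓS (Submodule.subset_span ⟨b, f, rfl⟩)
  rw [LinearMap.mem_ker, map_sub] at this
  exact sub_eq_zero.mp this

theorem act_act (g g' : symplecticGroup (Fin d) ℚ_[p]) (h : Heis p d) :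
    Heis.act g' (Heis.act g h) = Heis.act (g * g') h := by
  apply Heis.ext
  · exact vecMul_vecMul h.w g.1 g'.1
  · rfl

theorem act_one (h : Heis p d) : Heis.act 1 h = h := by
  apply Heis.ext
  · exact vecMul_one h.w
  · rfl

theorem act_inv_act (g : symplecticGroup (Fin d) ℚ_[p]) (h : Heis p d) :
    Heis.act g (Heis.act g⁻¹ h) = h := by
  rw [act_act, inv_mul_cancel, act_one]

theorem exists_act_transl_small (g : symplecticGroup (Fin d) ℚ_[p])
    (e : (Fin d → ℚ_[p]) → Heis p d) (he : Continuous fun x => (e x).w) (he0 : (e 0).w = 0)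
    {ε : ℝ} (hε : 0 < ε) : ∃ η > 0, ∀ x, ‖x‖ < η → ‖(Heis.act g (e x)).w‖ < ε := by
  have h1 : Continuous fun x => (Heis.act g (e x)).w := by
    have : Continuous fun v : Fin d ⊕ Fin d → ℚ_[p] => v ᵥ* g.1 := by fun_prop
    exact this.comp he
  have h2 := Metric.continuous_iff.mp h1 0 ε hε
  obtain ⟨η, hη, h⟩ := h2
  refine ⟨η, hη, fun x hx => ?_⟩
  have h3 := h x (by simpa using hx)
  have h4 : (Heis.act g (e 0)).w = 0 := by
    change (e 0).w ᵥ* g.1 = 0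
    rw [he0, zero_vecMul]
  rwa [h4, dist_zero_right] at h3

/-- For every symplectic `g` an intertwining operator exists. -/
theorem exists_intertwiner (ψ : SmoothChar p) (g : symplecticGroup (Fin d) ℚ_[p]) :
    ∃ T : Schw p d ≃ₗ[ℂ_[p]] Schw p d, IsIntertwiner ψ g T := by
  obtain ⟨ℓ, hℓ0, hℓ⟩ := exists_functional ψ g
  let F : Schw p d → (Fin d → ℚ_[p]) → ℂ_[p] :=
    fun f x => ℓ (schrodinger ψ d (Heis.act g (transl x)) f)
  have hcentral : ∀ (t : ℚ_[p]) (f : Schw p d),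
      schrodinger ψ d ⟨0, t⟩ f = ψ.toAddChar t • f := by
    intro t f
    ext x
    have h1 : (0 : Fin d ⊕ Fin d → ℚ_[p]) ∘ Sum.inl = 0 := rfl
    have h2 : (0 : Fin d ⊕ Fin d → ℚ_[p]) ∘ Sum.inr = 0 := rfl
    rw [schrodinger_apply]
    simp [h1, h2]
  have hF : ∀ f, F f ∈ Schw p d := by
    intro f
    obtain ⟨ε, hε, hfix⟩ := exists_fixing ψ f
    constructor
    · obtain ⟨η, hη, h⟩ := exists_act_transl_small g transl
        (continuous_pi fun i => by rcases i with i | i <;> simp only [transl, Sum.elim_inl,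
          Sum.elim_inr] <;> fun_prop)
        (by ext i; rcases i with i | i <;> rfl) hε
      rw [IsLocallyConstant.iff_eventually_eq]
      intro x
      filter_upwards [Metric.ball_mem_nhds x hη] with y hy
      have e1 : (transl y : Heis p d) = transl x * transl (y - x) := by
        apply Heis.ext
        · ext i
          rcases i with i | i <;> simp [transl]
        · simp [transl, symp]
      simp only [F]
      rw [e1, map_mul, map_mul, Module.End.mul_apply,
        hfix (Heis.act g (transl (y - x))) rfl (h _ (by rwa [Metric.mem_ball, dist_eq_norm] at hy))]
    · obtain ⟨η, hη, h⟩ := exists_act_transl_small g modul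
        (continuous_pi fun i => by rcases i with i | i <;> simp only [modul, Sum.elim_inl,
          Sum.elim_inr] <;> fun_prop)
        (by ext i; rcases i with i | i <;> rfl) hε
      have hx : ∀ x, F f x ≠ 0 → ∀ b, ‖b‖ < η → ψ.toAddChar (b ⬝ᵥ x) = 1 := by
        intro x hx b hb
        have e1 : (transl x : Heis p d) * modul b = ⟨0, b ⬝ᵥ x⟩ * (modul b * transl x) := by
          apply Heis.ext
          · ext i
            rcases i with i | i <;> simp [transl, modul]
          · simp [transl, modul, symp]
            rw [dotProduct_comm x b]; ring
        have e0 : Heis.act g ⟨0, b ⬝ᵥ x⟩ = ⟨0, b ⬝ᵥ x⟩ := by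
          apply Heis.ext
          · exact zero_vecMul g.1
          · rfl
        have e2 := congrArg (fun k => ℓ (schrodinger ψ d (Heis.act g k) f)) e1
        simp only [map_mul, Module.End.mul_apply] at e2
        rw [hfix (Heis.act g (modul b)) rfl (h b hb), e0, hcentral, map_smul, hℓ,
          smul_eq_mul] at e2
        exact (mul_eq_right₀ hx).mp e2.symm
      obtain ⟨r, hr⟩ := ψ.nontrivial
      refine HasCompactSupport.intro (isCompact_closedBall (0 : Fin d → ℚ_[p]) (‖r‖ / η)) ?_
      intro x hxb
      by_contra hne
      rw [mem_closedBall_zero_iff, pi_norm_le_iff_of_nonneg (by positivity)] at hxb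
      push Not at hxb
      obtain ⟨i, hi⟩ := hxb
      have hxi : 0 < ‖x i‖ := lt_of_le_of_lt (by positivity) hi
      refine hr ?_
      have h1 := hx x hne (Pi.single i (r / x i)) (by
        rw [Pi.norm_single, norm_div, div_lt_iff₀ hxi]
        rw [div_lt_iff₀ hη] at hi
        linarith)
      rwa [single_dotProduct, div_mul_cancel₀ _ (norm_pos_iff.mp hxi)] at h1
  let T : Schw p d →ₗ[ℂ_[p]] Schw p d :=
    { toFun := fun f => ⟨F f, hF f⟩
      map_add' := fun f f' => by ext x; simp [F]
      map_smul' := fun c f => by ext x; simp [F] }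
  have hT : ∀ (h : Heis p d) (f : Schw p d),
      schrodinger ψ d h (T f) = T (schrodinger ψ d (Heis.act g h) f) := by
    intro h f
    ext x
    rw [schrodinger_apply]
    change _ * ℓ _ = ℓ _
    set a := h.w ∘ Sum.inl with ha
    set b := h.w ∘ Sum.inr with hb
    have e1 : (transl x : Heis p d) * h =
        ⟨0, h.t + a ⬝ᵥ b / 2 + b ⬝ᵥ x⟩ * (modul b * transl (x + a)) := by
      apply Heis.ext
      · ext i
        rcases i with i | i <;> simp [transl, modul, ha, hb]
      · simp only [transl, modul, mul_t, mul_w, symp, ← ha, ← hb, Sum.elim_comp_inl,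
          Sum.elim_comp_inr, zero_dotProduct, dotProduct_add]
        have h1 : (0 : Fin d ⊕ Fin d → ℚ_[p]) ∘ Sum.inl = 0 := rfl
        have h2 : (0 : Fin d ⊕ Fin d → ℚ_[p]) ∘ Sum.inr = 0 := rfl
        rw [h1, h2, zero_dotProduct, zero_dotProduct, dotProduct_comm x b, dotProduct_comm a b]
        ring
    have e0 : ∀ t : ℚ_[p], Heis.act g ⟨0, t⟩ = ⟨0, t⟩ := by
      intro t
      apply Heis.ext
      · exact zero_vecMul g.1
      · rfl
    rw [← Module.End.mul_apply (schrodinger ψ d _), ← map_mul, ← map_mul, e1]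
    simp only [map_mul, Module.End.mul_apply]
    rw [e0, hcentral, map_smul, hℓ, smul_eq_mul]
  have hT0 : T ≠ 0 := by
    intro h0
    apply hℓ0
    ext f
    have h1 : F f 0 = 0 := by
      have : T f = 0 := by rw [h0]; rfl
      exact congrFun (congrArg Subtype.val this) 0
    have h2 : (transl 0 : Heis p d) = 1 := by
      apply Heis.ext
      · ext i; rcases i with i | i <;> rfl
      · rfl
    simp only [F] at h1
    rw [h2, map_one, map_one] at h1
    exact h1
  have hker : LinearMap.ker T = ⊥ := by
    by_contra hne
    have := schrodinger_irreducible ψ (LinearMap.ker T) (fun h f hf => by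
      rw [LinearMap.mem_ker] at hf ⊢
      rw [← act_inv_act g h, ← hT, hf, map_zero]) hne
    exact hT0 (LinearMap.ker_eq_top.mp this)
  have hran : LinearMap.range T = ⊤ := by
    apply schrodinger_irreducible ψ
    · rintro h _ ⟨f, rfl⟩
      exact ⟨_, (hT h f).symm⟩
    · exact fun h => hT0 (LinearMap.range_eq_bot.mp h)
  exact ⟨LinearEquiv.ofBijective T ⟨LinearMap.ker_eq_bot.mp hker, LinearMap.range_eq_top.mp hran⟩,
    hT⟩

end Intertwiner

section AlphaNorm

variable {p : ℕ} [Fact p.Prime] {d : ℕ}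

/-- The sup norm on `𝒮(ℚ_p^d)`. -/
def supNorm (f : Schw p d) : ℝ := ⨆ x, ‖f.1 x‖

theorem bddAbove_norm (f : Schw p d) : BddAbove (Set.range fun x => ‖f.1 x‖) := by
  have h1 : HasCompactSupport fun x => ‖f.1 x‖ := f.2.2.comp_left (g := fun z => ‖z‖) norm_zero
  exact (h1.isCompact_range (f.2.1.continuous.norm)).bddAbove

theorem norm_le_supNorm (f : Schw p d) (x : Fin d → ℚ_[p]) : ‖f.1 x‖ ≤ supNorm f :=
  le_ciSup (bddAbove_norm f) x

theorem supNorm_nonneg (f : Schw p d) : 0 ≤ supNorm f :=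
  Real.iSup_nonneg fun _ => norm_nonneg _

theorem supNorm_add_le (f g : Schw p d) : supNorm (f + g) ≤ max (supNorm f) (supNorm g) := by
  refine ciSup_le fun x => ?_
  exact (IsUltrametricDist.norm_add_le_max (f.1 x) (g.1 x)).trans
    (max_le_max (norm_le_supNorm f x) (norm_le_supNorm g x))

theorem supNorm_smul (c : ℂ_[p]) (f : Schw p d) : supNorm (c • f) = ‖c‖ * supNorm f := by
  have h : ∀ x, ‖(c • f).1 x‖ = ‖c‖ * ‖f.1 x‖ := fun x => norm_mul c (f.1 x)
  simp only [supNorm, h]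
  exact (Real.mul_iSup_of_nonneg (norm_nonneg c) _).symm

theorem supNorm_eq_zero {f : Schw p d} (h : supNorm f = 0) : f = 0 := by
  ext x
  have h1 := norm_le_supNorm f x
  rw [h] at h1
  exact norm_le_zero_iff.mp h1

theorem supNorm_zero : supNorm (0 : Schw p d) = 0 := by
  simpa using supNorm_smul (0 : ℂ_[p]) (0 : Schw p d)

/-- The sup norm is invariant under the Heisenberg group. -/
theorem supNorm_schrodinger (ψ : SmoothChar p) (h : Heis p d) (f : Schw p d) :
    supNorm (schrodinger ψ d h f) = supNorm f := by
  simp only [supNorm, schrodinger_apply, norm_mul, ψ.norm_eq_one, one_mul]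
  exact (Equiv.addRight (h.w ∘ Sum.inl)).surjective.iSup_comp (fun x => ‖f.1 x‖)

/-- The Siegel parabolic subgroup: symplectic matrices `(a b; c d)` with `c = 0`. -/
def siegelParabolic (p : ℕ) [Fact p.Prime] (d : ℕ) :
    Subgroup (symplecticGroup (Fin d) ℚ_[p]) where
  carrier := {g | g.1.toBlocks₂₁ = 0}
  one_mem' := by
    change (1 : Matrix (Fin d ⊕ Fin d) (Fin d ⊕ Fin d) ℚ_[p]).toBlocks₂₁ = 0
    rw [← fromBlocks_one, toBlocks_fromBlocks₂₁]
  mul_mem' {g h} hg hh := by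
    change g.1.toBlocks₂₁ = 0 at hg
    change h.1.toBlocks₂₁ = 0 at hh
    change (g.1 * h.1).toBlocks₂₁ = 0
    conv_lhs => rw [← fromBlocks_toBlocks g.1, ← fromBlocks_toBlocks h.1]
    rw [fromBlocks_multiply, toBlocks_fromBlocks₂₁, hg, hh]; simp
  inv_mem' {g} hg := by
    change g.1.toBlocks₂₁ = 0 at hg
    change (-J (Fin d) ℚ_[p] * (g.1)ᵀ * J (Fin d) ℚ_[p]).toBlocks₂₁ = 0
    conv_lhs => rw [← fromBlocks_toBlocks g.1]
    rw [J, fromBlocks_transpose, fromBlocks_neg, fromBlocks_multiply, fromBlocks_multiply,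
      toBlocks_fromBlocks₂₁, hg]
    simp

/-- The space `P \ Sp_{2d}(ℚ_p)` of right cosets `P g` of the Siegel parabolic. -/
def Grassmannian (p : ℕ) [Fact p.Prime] (d : ℕ) : Type :=
  Quotient (QuotientGroup.rightRel (siegelParabolic p d))

/-- The point `P g`. -/
def Grassmannian.mk (g : symplecticGroup (Fin d) ℚ_[p]) : Grassmannian p d :=
  Quotient.mk _ g

/-- A representative of a point of the Grassmannian. -/
def Grassmannian.rep (α : Grassmannian p d) : symplecticGroup (Fin d) ℚ_[p] :=
  Quotient.out α

/-- A choice of an intertwining operator `T_g`. -/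
def weilOp (ψ : SmoothChar p) (g : symplecticGroup (Fin d) ℚ_[p]) :
    Schw p d ≃ₗ[ℂ_[p]] Schw p d :=
  Classical.choose (exists_intertwiner ψ g)

theorem weilOp_spec (ψ : SmoothChar p) (g : symplecticGroup (Fin d) ℚ_[p]) :
    IsIntertwiner ψ g (weilOp ψ g) :=
  Classical.choose_spec (exists_intertwiner ψ g)

/-- The characteristic function of `ℤ_p^d`. -/
def intFn (p : ℕ) [Fact p.Prime] (d : ℕ) : Schw p d :=
  charFn {x | ∀ i, ‖x i‖ ≤ 1}
    (by
      have h : {x : Fin d → ℚ_[p] | ∀ i, ‖x i‖ ≤ 1} = Metric.closedBall 0 1 := by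
        ext x; simp [pi_norm_le_iff_of_nonneg]
      rw [h]; exact IsUltrametricDist.isClopen_closedBall 0 one_ne_zero)
    (by
      have h : {x : Fin d → ℚ_[p] | ∀ i, ‖x i‖ ≤ 1} = Metric.closedBall 0 1 := by
        ext x; simp [pi_norm_le_iff_of_nonneg]
      rw [h]; exact isCompact_closedBall 0 1)

theorem intFn_ne_zero : intFn p d ≠ 0 := by
  intro h
  have h1 : (intFn p d).1 0 = 0 := by rw [h]; rfl
  have h2 : (intFn p d).1 0 = 1 := Set.indicator_of_mem (by simp) _
  exact one_ne_zero (h2.symm.trans h1)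

/-- The norm `‖·‖_α` for `α = P g`: the multiple of `f ↦ ‖T_g f‖_sup` which takes the value `1`
at the characteristic function of `ℤ_p^d`. By `alphaNorm_eq` it does not depend on the choice of
`g` and `T_g`. -/
def alphaNorm (ψ : SmoothChar p) (α : Grassmannian p d) (f : Schw p d) : ℝ :=
  supNorm (weilOp ψ α.rep f) / supNorm (weilOp ψ α.rep (intFn p d))

theorem functional_eq_eval (ψ : SmoothChar p) (m : Schw p d →ₗ[ℂ_[p]] ℂ_[p])
    (hm : ∀ b f, m (schrodinger ψ d (modul b) f) = m f) (f : Schw p d) :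
    m f = m (ballFn 0 1) * f.1 0 := by
  have key : ∀ ε > 0, ∀ f : Schw p d, (∀ x y, ‖y‖ < ε → f.1 (x + y) = f.1 x) →
      m f = m (ballFn 0 ε) * f.1 0 := by
    intro ε hε f hf
    let ev : Schw p d →ₗ[ℂ_[p]] ℂ_[p] := LinearMap.proj 0 ∘ₗ (Schw p d).subtype
    obtain ⟨s, hs⟩ := exists_cover f hε
    have h1 := mem_span_balls (LinearMap.ker (m - m (ballFn 0 ε) • ev)) (ε := ε) ?_ s f hf hs
    · rw [LinearMap.mem_ker] at h1
      exact sub_eq_zero.mp h1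
    · intro c
      rw [LinearMap.mem_ker]
      change m (ballFn c ε) - m (ballFn 0 ε) * (ballFn c ε).1 0 = 0
      by_cases hc : ‖0 - c‖ < ε
      · have : ballFn c ε = ballFn 0 ε := by
          ext x
          by_cases hx : ‖x - 0‖ < ε
          · rw [ballFn_of_mem hx, ballFn_of_mem (norm_sub_lt_trans hx hc)]
          · rw [ballFn_of_notMem hx, ballFn_of_notMem fun h =>
              hx (norm_sub_lt_trans h (by rwa [norm_sub_rev]))]
        rw [this, ballFn_of_mem (by simpa using hε), mul_one, sub_self]
      · rw [ballFn_of_notMem hc, mul_zero, sub_zero]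
        rw [zero_sub, norm_neg, not_lt] at hc
        obtain ⟨b, hb, hb'⟩ := exists_sep_vec ψ hε hc
        have h2 : schrodinger ψ d (modul b) (ballFn c ε) = ψ.toAddChar (b ⬝ᵥ c) • ballFn c ε := by
          ext x
          rw [schrodinger_modul]
          change _ = ψ.toAddChar (b ⬝ᵥ c) * (ballFn c ε).1 x
          by_cases hx : ‖x - c‖ < ε
          · have h3 := hb' _ hx
            rw [dotProduct_sub, AddChar.map_sub_eq_div, div_eq_one_iff_eq (ψ.ne_zero _)] at h3
            rw [h3]
          · rw [ballFn_of_notMem hx, mul_zero, mul_zero]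
        have h4 := hm b (ballFn c ε)
        rw [h2, map_smul, smul_eq_mul] at h4
        by_contra h5
        exact hb ((mul_eq_right₀ h5).mp h4)
  obtain ⟨ε, hε, hf⟩ := exists_invariant f
  have h1 := key (min ε 1) (by positivity) f
    (fun x y hy => hf x y (hy.trans_le (min_le_left _ _)))
  have h2 := key (min ε 1) (by positivity) (ballFn 0 1) (by
    intro x y hy
    have hy1 : ‖y‖ < 1 := hy.trans_le (min_le_right _ _)
    by_cases hx : ‖x - 0‖ < 1
    · rw [ballFn_of_mem hx, ballFn_of_mem (norm_sub_lt_trans (y := x) (by simpa using hy1) hx)]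
    · rw [ballFn_of_notMem hx, ballFn_of_notMem fun h =>
        hx (norm_sub_lt_trans (y := x + y) (by simpa using hy1) h)])
  rw [ballFn_of_mem (by simp), mul_one] at h2
  rw [h1, h2]

/-- For `q` in the Siegel parabolic, intertwining operators attached to `g` and to `q g` give
homothetic norms. -/
theorem supNorm_homothetic (ψ : SmoothChar p) {g q : symplecticGroup (Fin d) ℚ_[p]}
    (hq : q ∈ siegelParabolic p d) {T T' : Schw p d ≃ₗ[ℂ_[p]] Schw p d}
    (hT : IsIntertwiner ψ g T) (hT' : IsIntertwiner ψ (q * g) T') :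
    ∃ r : ℝ, 0 < r ∧ ∀ f, supNorm (T' f) = r * supNorm (T f) := by
  set A : Schw p d ≃ₗ[ℂ_[p]] Schw p d := T.symm.trans T' with hA
  have hAh : ∀ h f, schrodinger ψ d h (A f) = A (schrodinger ψ d (Heis.act q h) f) := by
    intro h f
    rw [hA, LinearEquiv.trans_apply, LinearEquiv.trans_apply, hT', ← act_act]
    congr 1
    rw [LinearEquiv.eq_symm_apply, ← hT, LinearEquiv.apply_symm_apply]
  have hmodul : ∀ s ∈ siegelParabolic p d, ∀ b, ∃ b', Heis.act s (modul b) = modul b' := by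
    intro s hs b
    have hs' : s.1.toBlocks₂₁ = 0 := hs
    refine ⟨b ᵥ* s.1.toBlocks₂₂, ?_⟩
    rw [act_modul, hs', vecMul_zero]; rfl
  let m : Schw p d →ₗ[ℂ_[p]] ℂ_[p] := LinearMap.proj 0 ∘ₗ (Schw p d).subtype ∘ₗ A.toLinearMap
  have hmA : ∀ f, m f = (A f).1 0 := fun f => rfl
  have hm : ∀ b f, m (schrodinger ψ d (modul b) f) = m f := by
    intro b f
    obtain ⟨b', hb'⟩ := hmodul q⁻¹ ((siegelParabolic p d).inv_mem hq) b
    rw [← act_inv_act q (modul b), hb', hmA, ← hAh, schrodinger_modul, dotProduct_zero,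
      AddChar.map_zero_eq_one, one_mul, hmA]
  have hAx : ∀ f x, ‖(A f).1 x‖ =
      ‖m (ballFn 0 1)‖ * ‖f.1 ((Heis.act q (transl x)).w ∘ Sum.inl)‖ := by
    intro f x
    have h1 : (A f).1 x = m (schrodinger ψ d (Heis.act q (transl x)) f) := by
      rw [hmA, ← hAh, schrodinger_transl, zero_add]
    rw [h1, functional_eq_eval ψ m hm, schrodinger_apply, norm_mul, norm_mul, ψ.norm_eq_one,
      one_mul, zero_add]
  have hsurj : Function.Surjective fun x => (Heis.act q (transl x)).w ∘ Sum.inl := by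
    intro y
    set h := Heis.act q⁻¹ (transl y) with hh
    refine ⟨h.w ∘ Sum.inl, ?_⟩
    have h1 : h.w = (transl (h.w ∘ Sum.inl)).w + (modul (h.w ∘ Sum.inr)).w := by
      ext i
      rcases i with i | i <;> simp [transl, modul]
    have h2 : (Heis.act q h).w = (Heis.act q (transl (h.w ∘ Sum.inl))).w +
        (Heis.act q (modul (h.w ∘ Sum.inr))).w := by
      change h.w ᵥ* q.1 = _ ᵥ* q.1 + _ ᵥ* q.1
      rw [← add_vecMul, ← h1]
    obtain ⟨b', hb'⟩ := hmodul q hq (h.w ∘ Sum.inr)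
    rw [hb', hh, act_inv_act, ← hh] at h2
    have h3 := congrArg (fun v : Fin d ⊕ Fin d → ℚ_[p] => v ∘ Sum.inl) h2
    ext i
    have h4 := congrFun h3 i
    simp only [transl, modul, Function.comp_apply, Pi.add_apply, Sum.elim_inl, Pi.zero_apply,
      add_zero] at h4 ⊢
    exact h4.symm
  have hAn : ∀ f, supNorm (A f) = ‖m (ballFn 0 1)‖ * supNorm f := by
    intro f
    simp only [supNorm, hAx]
    rw [← Real.mul_iSup_of_nonneg (norm_nonneg _)]
    congr 1
    exact hsurj.iSup_comp (fun x => ‖f.1 x‖)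
  refine ⟨‖m (ballFn 0 1)‖, ?_, fun f => ?_⟩
  · refine lt_of_le_of_ne (norm_nonneg _) fun h0 => ?_
    have h1 := hAn (intFn p d)
    rw [← h0, zero_mul] at h1
    exact intFn_ne_zero (A.map_eq_zero_iff.mp (supNorm_eq_zero h1))
  · rw [← hAn, hA, LinearEquiv.trans_apply, LinearEquiv.symm_apply_apply]

theorem supNorm_weilOp_pos (ψ : SmoothChar p) (g : symplecticGroup (Fin d) ℚ_[p]) :
    0 < supNorm (weilOp ψ g (intFn p d)) :=
  lt_of_le_of_ne (supNorm_nonneg _) fun h =>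
    intFn_ne_zero ((weilOp ψ g).map_eq_zero_iff.mp (supNorm_eq_zero h.symm))

/-- The norm `‖·‖_α` may be computed from any representative `g` of `α` and any intertwining
operator attached to `g`. -/
theorem alphaNorm_eq (ψ : SmoothChar p) (g : symplecticGroup (Fin d) ℚ_[p])
    (T : Schw p d ≃ₗ[ℂ_[p]] Schw p d) (hT : IsIntertwiner ψ g T) (f : Schw p d) :
    alphaNorm ψ (Grassmannian.mk g) f = supNorm (T f) / supNorm (T (intFn p d)) := by
  set g₀ := (Grassmannian.mk g).rep with hg₀
  have h1 : QuotientGroup.rightRel (siegelParabolic p d) g₀ g :=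
    Quotient.exact (Quotient.out_eq (Grassmannian.mk g))
  rw [QuotientGroup.rightRel_apply] at h1
  have h2 : IsIntertwiner ψ (g * g₀⁻¹ * g₀) T := by rwa [inv_mul_cancel_right]
  obtain ⟨r, hr, h⟩ := supNorm_homothetic ψ h1 (weilOp_spec ψ g₀) h2
  rw [h, h, mul_div_mul_left _ _ hr.ne']
  rfl

theorem alphaNorm_nonneg (ψ : SmoothChar p) (α : Grassmannian p d) (f : Schw p d) :
    0 ≤ alphaNorm ψ α f := div_nonneg (supNorm_nonneg _) (supNorm_nonneg _)

theorem alphaNorm_intFn (ψ : SmoothChar p) (α : Grassmannian p d) :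
    alphaNorm ψ α (intFn p d) = 1 := div_self (supNorm_weilOp_pos ψ _).ne'

theorem alphaNorm_zero (ψ : SmoothChar p) (α : Grassmannian p d) : alphaNorm ψ α 0 = 0 := by
  rw [alphaNorm, map_zero, supNorm_zero, zero_div]

theorem alphaNorm_add_le_max (ψ : SmoothChar p) (α : Grassmannian p d) (f g : Schw p d) :
    alphaNorm ψ α (f + g) ≤ max (alphaNorm ψ α f) (alphaNorm ψ α g) := by
  have h := supNorm_weilOp_pos ψ α.rep
  rw [alphaNorm, alphaNorm, alphaNorm, max_div_div_right h.le, map_add]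
  exact div_le_div_of_nonneg_right (supNorm_add_le _ _) h.le

theorem alphaNorm_smul (ψ : SmoothChar p) (α : Grassmannian p d) (c : ℂ_[p]) (f : Schw p d) :
    alphaNorm ψ α (c • f) = ‖c‖ * alphaNorm ψ α f := by
  rw [alphaNorm, map_smul, supNorm_smul, mul_div_assoc, alphaNorm]

theorem alphaNorm_eq_zero (ψ : SmoothChar p) (α : Grassmannian p d) {f : Schw p d}
    (h : alphaNorm ψ α f = 0) : f = 0 := by
  rcases div_eq_zero_iff.mp h with h | h
  · exact (weilOp ψ α.rep).map_eq_zero_iff.mp (supNorm_eq_zero h)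
  · exact absurd h (supNorm_weilOp_pos ψ α.rep).ne'

/-- The norm `‖·‖_α` is invariant under the Heisenberg group. -/
theorem alphaNorm_schrodinger (ψ : SmoothChar p) (α : Grassmannian p d) (h : Heis p d)
    (f : Schw p d) : alphaNorm ψ α (schrodinger ψ d h f) = alphaNorm ψ α f := by
  rw [alphaNorm, ← act_inv_act α.rep h, ← weilOp_spec, supNorm_schrodinger, alphaNorm]

/-- The space `𝒮(ℚ_p^d)` equipped with the norm `‖·‖_α`. -/
def SchwAlpha (_ψ : SmoothChar p) (_α : Grassmannian p d) : Type := Schw p d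

variable (ψ : SmoothChar p) (α : Grassmannian p d)

instance : AddCommGroup (SchwAlpha ψ α) := inferInstanceAs (AddCommGroup (Schw p d))

instance : Module ℂ_[p] (SchwAlpha ψ α) := inferInstanceAs (Module ℂ_[p] (Schw p d))

/-- The identity map, as a linear equivalence. -/
def toAlpha : Schw p d ≃ₗ[ℂ_[p]] SchwAlpha ψ α := LinearEquiv.refl ℂ_[p] (Schw p d)

instance : NormedAddCommGroup (SchwAlpha ψ α) :=
  AddGroupNorm.toNormedAddCommGroup
    { toFun := fun f => alphaNorm ψ α ((toAlpha ψ α).symm f)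
      map_zero' := by rw [map_zero, alphaNorm_zero]
      add_le' := fun f g => by
        rw [map_add]
        exact (alphaNorm_add_le_max ψ α _ _).trans
          (max_le_add_of_nonneg (alphaNorm_nonneg ψ α _) (alphaNorm_nonneg ψ α _))
      neg' := fun f => by
        rw [map_neg, ← neg_one_smul ℂ_[p], alphaNorm_smul, norm_neg, norm_one, one_mul]
      eq_zero_of_map_eq_zero' := fun f hf =>
        (toAlpha ψ α).symm.map_eq_zero_iff.mp (alphaNorm_eq_zero ψ α hf) }

theorem norm_toAlpha (f : Schw p d) : ‖toAlpha ψ α f‖ = alphaNorm ψ α f := rfl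

instance : NormedSpace ℂ_[p] (SchwAlpha ψ α) where
  norm_smul_le c f := (alphaNorm_smul ψ α c ((toAlpha ψ α).symm f)).le

/-- The completion of `𝒮(ℚ_p^d)` with respect to `‖·‖_α`. -/
abbrev AlphaCompletion : Type := UniformSpace.Completion (SchwAlpha ψ α)

/-- The action of an element of the Heisenberg group on `(𝒮(ℚ_p^d), ‖·‖_α)`. -/
def alphaAct (h : Heis p d) : SchwAlpha ψ α →L[ℂ_[p]] SchwAlpha ψ α :=
  LinearMap.mkContinuous
    ((toAlpha ψ α).toLinearMap ∘ₗ schrodinger ψ d h ∘ₗ (toAlpha ψ α).symm.toLinearMap) 1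
    (fun f => by
      rw [one_mul]
      exact (alphaNorm_schrodinger ψ α h ((toAlpha ψ α).symm f)).le)

/-- The action of the Heisenberg group on the completion, extending `ρ_ψ` by continuity. -/
def alphaRep : Representation ℂ_[p] (Heis p d) (AlphaCompletion ψ α) where
  toFun h := (alphaAct ψ α h).completion.toLinearMap
  map_one' := by
    ext v
    induction v using UniformSpace.Completion.induction_on with
    | hp => exact isClosed_eq (alphaAct ψ α 1).completion.continuous continuous_id
    | ih f =>
      change (alphaAct ψ α 1).completion (f : AlphaCompletion ψ α) = f
      rw [ContinuousLinearMap.completion_apply_coe]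
      congr 1
      change schrodinger ψ d 1 f = f
      rw [map_one]; rfl
  map_mul' g h := by
    ext v
    induction v using UniformSpace.Completion.induction_on with
    | hp =>
      exact isClosed_eq (alphaAct ψ α (g * h)).completion.continuous
        ((alphaAct ψ α g).completion.continuous.comp (alphaAct ψ α h).completion.continuous)
    | ih f =>
      change (alphaAct ψ α (g * h)).completion (f : AlphaCompletion ψ α) =
        (alphaAct ψ α g).completion ((alphaAct ψ α h).completion (f : AlphaCompletion ψ α))
      rw [ContinuousLinearMap.completion_apply_coe, ContinuousLinearMap.completion_apply_coe,
        ContinuousLinearMap.completion_apply_coe]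
      congr 1
      change schrodinger ψ d (g * h) f = schrodinger ψ d g (schrodinger ψ d h f)
      rw [map_mul]; rfl

theorem alphaRep_coe (h : Heis p d) (f : Schw p d) :
    alphaRep ψ α h (toAlpha ψ α f : AlphaCompletion ψ α) = toAlpha ψ α (schrodinger ψ d h f) :=
  (alphaAct ψ α h).completion_apply_coe (toAlpha ψ α f)

end AlphaNorm

section BanachRep

variable {p : ℕ} [Fact p.Prime] {G : Type*} [Group G] {B : Type*} [NormedAddCommGroup B]
  [NormedSpace ℂ_[p] B]

/-- A Banach representation over `ℂ_p` of an abstract group: the norm is non-archimedean, complete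
and `G`-invariant. -/
structure IsBanachRep (π : Representation ℂ_[p] G B) : Prop where
  norm_add_le_max : ∀ v w : B, ‖v + w‖ ≤ max ‖v‖ ‖w‖
  complete : CompleteSpace B
  invariant : ∀ (g : G) (v : B), ‖π g v‖ = ‖v‖

/-- Topological irreducibility: a nonzero representation whose only closed
subrepresentations are `0` and the whole space. -/
structure IsTopIrreducible (π : Representation ℂ_[p] G B) : Prop where
  nontrivial : Nontrivial B
  eq_bot_or_eq_top : ∀ W : Submodule ℂ_[p] B, IsClosed (W : Set B) →
    (∀ (g : G) (v : B), v ∈ W → π g v ∈ W) → W = ⊥ ∨ W = ⊤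

end BanachRep

/-- The completion of `𝒮(ℚ_p^d)` in the norm `‖·‖_α` is a Banach representation. -/
theorem isBanachRep_alphaRep {p : ℕ} [Fact p.Prime] {d : ℕ} (ψ : SmoothChar p)
    (α : Grassmannian p d) : IsBanachRep (alphaRep ψ α) where
  norm_add_le_max v w := by
    induction v, w using UniformSpace.Completion.induction_on₂ with
    | hp => exact isClosed_le (by fun_prop) (by fun_prop)
    | ih f g =>
      rw [← UniformSpace.Completion.coe_add, UniformSpace.Completion.norm_coe,
        UniformSpace.Completion.norm_coe, UniformSpace.Completion.norm_coe]
      exact alphaNorm_add_le_max ψ α _ _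
  complete := inferInstance
  invariant h v := by
    induction v using UniformSpace.Completion.induction_on with
    | hp =>
      exact isClosed_eq ((alphaAct ψ α h).completion.continuous.norm) continuous_norm
    | ih f =>
      change ‖(alphaAct ψ α h).completion (f : AlphaCompletion ψ α)‖ = _
      rw [ContinuousLinearMap.completion_apply_coe, UniformSpace.Completion.norm_coe,
        UniformSpace.Completion.norm_coe]
      exact alphaNorm_schrodinger ψ α h _

end

end PadicHeis

open PadicHeis

/-! Everything rests on a quantitative irreducibility of the completion
(`isStronglyIrreducible_alphaRep`): if `‖w‖ < ρ ‖u‖`, then `w` is a limit of finite sums of vectors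
`c • g u` with `‖c‖ ≤ ρ`. Since norms are invariant and ultrametric, such sums have norm at most `ρ
‖u‖`, and so do their images under an equivariant map, with `u` replaced by its image.

For a map `F` out of the completion this gives `‖F w‖ ≤ ρ ‖F u‖` for every `ρ > ‖w‖ / ‖u‖`.
Exchanging `u` and `w` shows that `‖F v‖ / ‖v‖` is constant. The range is then closed, hence
everything, because `B` is irreducible. For a map into the completion, irreducibility of `B` gives
injectivity, and successive approximation, as in the open mapping theorem, solves `F v' = w` with
`‖v'‖ ≤ ρ ‖v‖` as soon as `‖w‖ < ρ ‖F v‖`. Injectivity turns this into the reverse inequality of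
norms, so `F` is again a homothety.

An operator `T_g` reduces strong irreducibility to the sup norm on locally constant functions. There
it suffices to produce the characteristic function of a small ball from a function `f` of sup norm
1. The group multiplies `f` by characters, so what is needed is a combination of characters, close
to 1 on a small ball and close to 0 on the rest of a large one, with coefficients barely larger than
1. Finite Fourier inversion gives coefficients as large as the index of the balls, which is useless.

Instead (`IsNormalizedChar.exists_multiplier`), use that `χ x - 1` is small in a way governed by
`‖x‖`: for `‖x‖ = p ^ k` its size is that of `ζ - 1`, `ζ` of order `p ^ (k + 1)`, which tends to 1
as `k` grows. A product of factors `χ (x - y) - 1`, with `y` spread over the annulus, is small there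
but remains near absolute value 1 at the origin. On the inner ball it is, up to a constant, a power
series in `χ x - 1` with constant term 1; multiplying by a truncated inverse makes it close to 1,
and all coefficients stay bounded by `R ^ 2` with `R > 1` arbitrary. -/

namespace PadicHeis

noncomputable section

/-! ### Absolute values of `χ x - 1`, and products of such factors. -/

section CharNorm

variable {p : ℕ} [Fact p.Prime]

/-- An additive character of `ℚ_p` which is trivial on `p ℤ_p` but not on `ℤ_p`. -/
structure IsNormalizedChar (χ : AddChar ℚ_[p] ℂ_[p]) : Prop where
  eq_one : ∀ y, ‖y‖ < 1 → χ y = 1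
  ne_one : χ 1 ≠ 1

theorem one_lt_prime_real : (1 : ℝ) < p := by exact_mod_cast (Fact.out : p.Prime).one_lt

theorem prime_real_pos : (0 : ℝ) < p := zero_lt_one.trans one_lt_prime_real

theorem norm_prime_padicComplex : ‖(p : ℂ_[p])‖ = (p : ℝ)⁻¹ := by
  have h := norm_algebraMap' ℂ_[p] (p : ℚ_[p])
  rwa [map_natCast, Padic.norm_p] at h

/-- The common absolute value `p ^ (-1 / ((p - 1) p ^ k))` of `ζ - 1`, for `ζ` a primitive
`p ^ (k + 1)`-th root of unity. -/
def rootGap (p k : ℕ) : ℝ := (p : ℝ) ^ (-(1 / (((p : ℝ) - 1) * (p : ℝ) ^ k)))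

theorem rootGap_pow (k N : ℕ) :
    rootGap p k ^ N = (p : ℝ) ^ (-((N : ℝ) / (((p : ℝ) - 1) * (p : ℝ) ^ k))) := by
  rw [rootGap, ← Real.rpow_natCast, ← Real.rpow_mul prime_real_pos.le]
  congr 1
  ring

theorem rootGap_pos (k : ℕ) : 0 < rootGap p k := Real.rpow_pos_of_pos prime_real_pos _

theorem rootGap_lt_one (k : ℕ) : rootGap p k < 1 := by
  have hp := one_lt_prime_real (p := p)
  refine Real.rpow_lt_one_of_one_lt_of_neg hp (neg_lt_zero.mpr (one_div_pos.mpr ?_))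
  exact mul_pos (by linarith) (pow_pos prime_real_pos _)

theorem rootGap_mono : Monotone (rootGap p) := by
  have hp := one_lt_prime_real (p := p)
  intro k l hkl
  refine Real.rpow_le_rpow_of_exponent_le hp.le (neg_le_neg ?_)
  refine one_div_le_one_div_of_le (mul_pos (by linarith) (pow_pos prime_real_pos _)) ?_
  exact mul_le_mul_of_nonneg_left (pow_le_pow_right₀ hp.le hkl) (by linarith)

/-- Shrinking the radius by one factor `p` raises the size of `χ x - 1` to the power `p`. This gap
is what makes the expansion on the inner ball converge. -/
theorem rootGap_succ_pow (k : ℕ) : rootGap p (k + 1) ^ p = rootGap p k := by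
  have hp := one_lt_prime_real (p := p)
  rw [rootGap_pow, rootGap]
  congr 2
  have : (p : ℝ) - 1 ≠ 0 := by linarith
  have : (p : ℝ) ≠ 0 := by linarith
  field_simp
  ring

/-- The primitive roots are powers of one another, so all the `1 - ξ` have the same absolute value.
There are `p ^ k * (p - 1)` of them, and their product is the cyclotomic value `Φ(1) = p`. -/
theorem norm_sub_one_of_isPrimitiveRoot {k : ℕ} {ζ : ℂ_[p]}
    (h : IsPrimitiveRoot ζ (p ^ (k + 1))) : ‖ζ - 1‖ = rootGap p k := by
  have hp := one_lt_prime_real (p := p)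
  have hpp : p.Prime := Fact.out
  have hpos : 0 < p ^ (k + 1) := pow_pos hpp.pos _
  have hone : ∀ {ξ : ℂ_[p]}, IsPrimitiveRoot ξ (p ^ (k + 1)) → ‖ξ‖ = 1 := fun hξ => by
    have := congrArg norm hξ.pow_eq_one
    rw [norm_pow, norm_one] at this
    exact (pow_eq_one_iff_of_nonneg (norm_nonneg _) hpos.ne').mp this
  have hle : ∀ {ξ : ℂ_[p]}, ‖ξ‖ = 1 → ∀ n : ℕ, ‖ξ ^ n - 1‖ ≤ ‖ξ - 1‖ := by
    intro ξ hξ n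
    rw [← mul_geom_sum, norm_mul]
    refine mul_le_of_le_one_right (norm_nonneg _) ?_
    exact IsUltrametricDist.norm_sum_le_of_forall_le_of_nonneg zero_le_one
      fun i _ => by rw [norm_pow, hξ, one_pow]
  have heq : ∀ ξ ∈ primitiveRoots (p ^ (k + 1)) ℂ_[p], ‖1 - ξ‖ = ‖ζ - 1‖ := by
    intro ξ hξ
    rw [mem_primitiveRoots hpos] at hξ
    rw [norm_sub_rev]
    apply le_antisymm
    · obtain ⟨i, -, rfl⟩ := h.eq_pow_of_pow_eq_one hξ.pow_eq_one
      exact hle (hone h) i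
    · obtain ⟨i, -, rfl⟩ := hξ.eq_pow_of_pow_eq_one h.pow_eq_one
      exact hle (hone hξ) i
  have h1 := Polynomial.eval_one_cyclotomic_prime_pow (R := ℂ_[p]) (p := p) k
  rw [Polynomial.cyclotomic_eq_prod_X_sub_primitiveRoots h, Polynomial.eval_prod] at h1
  simp only [Polynomial.eval_sub, Polynomial.eval_X, Polynomial.eval_C] at h1
  have h2 := congrArg norm h1
  rw [norm_prod, Finset.prod_congr rfl heq, Finset.prod_const, h.card_primitiveRoots,
    norm_prime_padicComplex, Nat.totient_prime_pow_succ hpp] at h2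
  have hN : p ^ k * (p - 1) ≠ 0 :=
    mul_ne_zero (pow_pos hpp.pos _).ne' (Nat.sub_ne_zero_of_lt hpp.one_lt)
  rw [← pow_left_inj₀ (norm_nonneg _) (rootGap_pos k).le hN, h2, rootGap_pow]
  push_cast [Nat.cast_sub hpp.one_lt.le]
  rw [mul_comm ((p : ℝ) ^ k), div_self, Real.rpow_neg_one]
  exact mul_ne_zero (by linarith) (pow_pos prime_real_pos _).ne'

theorem norm_multiset_map_prod {ι K : Type*} [NormedField K] (Z : Multiset ι) (f : ι → K) :
    ‖(Z.map f).prod‖ = (Z.map fun y => ‖f y‖).prod := by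
  induction Z using Multiset.induction_on with
  | empty => simp
  | cons a s ih => simp [ih]

theorem norm_multiset_map_prod_le_one {ι K : Type*} [NormedField K] {Z : Multiset ι} {f : ι → K}
    (h : ∀ y ∈ Z, ‖f y‖ ≤ 1) : ‖(Z.map f).prod‖ ≤ 1 := by
  induction Z using Multiset.induction_on with
  | empty => simp
  | cons a s ih =>
    rw [Multiset.map_cons, Multiset.prod_cons, norm_mul]
    exact mul_le_one₀ (h a (by simp)) (norm_nonneg _)
      (ih fun y hy => h y (Multiset.mem_cons_of_mem hy))

theorem pow_card_le_norm_multiset_map_prod {ι K : Type*} [NormedField K] {Z : Multiset ι}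
    {f : ι → K} {c : ℝ} (hc : 0 ≤ c) (h : ∀ y ∈ Z, c ≤ ‖f y‖) :
    c ^ Z.card ≤ ‖(Z.map f).prod‖ := by
  induction Z using Multiset.induction_on with
  | empty => simp
  | cons a s ih =>
    rw [Multiset.map_cons, Multiset.prod_cons, norm_mul, Multiset.card_cons, pow_succ']
    exact mul_le_mul (h a (by simp)) (ih fun y hy => h y (Multiset.mem_cons_of_mem hy))
      (pow_nonneg hc _) (norm_nonneg _)

theorem exists_nat_norm_sub_le (n : ℕ) {x : ℚ_[p]} (hx : ‖x‖ ≤ 1) :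
    ∃ a : ℕ, a < p ^ n ∧ ‖x - a‖ ≤ (p : ℝ) ^ (-n : ℤ) := by
  refine ⟨PadicInt.appr ⟨x, hx⟩ n, PadicInt.appr_lt _ _, ?_⟩
  have h := PadicInt.appr_spec n (⟨x, hx⟩ : ℤ_[p])
  rw [← PadicInt.norm_le_pow_iff_mem_span_pow] at h
  rw [PadicInt.norm_def] at h
  exact h

theorem exists_norm_eq_pow {x : ℚ_[p]} (h : 1 ≤ ‖x‖) : ∃ l : ℕ, ‖x‖ = (p : ℝ) ^ l := by
  have hp := one_lt_prime_real (p := p)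
  have hx : x ≠ 0 := by rintro rfl; rw [norm_zero] at h; linarith
  have h1 := Padic.norm_eq_zpow_neg_valuation hx
  rw [h1] at h
  have h2 : 0 ≤ -x.valuation := (one_le_zpow_iff_right₀ hp).mp h
  obtain ⟨l, hl⟩ := Int.eq_ofNat_of_zero_le h2
  exact ⟨l, by rw [h1, hl]; exact zpow_natCast _ l⟩

namespace IsNormalizedChar

variable {χ : AddChar ℚ_[p] ℂ_[p]}

/-- Some integer multiple of the unit `x` is congruent to 1 modulo `p`, and `χ` is trivial on `p
ℤ_p`; so `χ x = 1` would force `χ 1 = 1`. -/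
theorem ne_one_of_norm_eq_one (hχ : IsNormalizedChar χ) {x : ℚ_[p]} (hx : ‖x‖ = 1) : χ x ≠ 1 := by
  have hp := one_lt_prime_real (p := p)
  intro h
  obtain ⟨a, -, ha⟩ := exists_nat_norm_sub_le 1 (x := x⁻¹) (by rw [norm_inv, hx, inv_one])
  apply hχ.ne_one
  have h1 : ‖(1 : ℚ_[p]) - a * x‖ < 1 := by
    have hx0 : x ≠ 0 := by rintro rfl; simp at hx
    have : (1 : ℚ_[p]) - a * x = (x⁻¹ - a) * x := by field_simp
    rw [this, norm_mul, hx, mul_one]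
    refine ha.trans_lt ?_
    simpa using inv_lt_one_of_one_lt₀ hp
  have h2 := hχ.eq_one _ h1
  have h3 : χ (a * x) = 1 := by
    rw [← nsmul_eq_mul, AddChar.map_nsmul_eq_pow, h, one_pow]
  rw [← sub_add_cancel (1 : ℚ_[p]) (a * x), AddChar.map_add_eq_mul, h2, h3, one_mul]

/-- Here `p ^ k * x` is a unit and `p ^ (k + 1) * x` lies in `p ℤ_p`, so `χ x` has order exactly `p
^ (k + 1)`. -/
theorem norm_sub_one (hχ : IsNormalizedChar χ) {x : ℚ_[p]} {k : ℕ} (hx : ‖x‖ = (p : ℝ) ^ k) :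
    ‖χ x - 1‖ = rootGap p k := by
  have hp := one_lt_prime_real (p := p)
  have hp0 : (p : ℝ) ≠ 0 := by linarith
  have key : ∀ n : ℕ, χ x ^ p ^ n = χ ((p : ℚ_[p]) ^ n * x) := by
    intro n
    rw [← AddChar.map_nsmul_eq_pow, nsmul_eq_mul]; push_cast; rfl
  have hn : ∀ n : ℕ, ‖(p : ℚ_[p]) ^ n * x‖ = (p : ℝ) ^ k / (p : ℝ) ^ n := by
    intro n
    rw [norm_mul, norm_pow, Padic.norm_p, hx, inv_pow]
    ring
  apply norm_sub_one_of_isPrimitiveRoot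
  rw [← orderOf_eq_prime_pow (x := χ x) (n := k) (p := p)]
  · exact IsPrimitiveRoot.orderOf _
  · rw [key]
    exact hχ.ne_one_of_norm_eq_one (by rw [hn, div_self (pow_ne_zero _ hp0)])
  · rw [key]
    apply hχ.eq_one
    rw [hn, div_lt_one (by positivity)]
    exact pow_lt_pow_right₀ hp (Nat.lt_succ_self k)

theorem norm_sub_one_le (hχ : IsNormalizedChar χ) {x : ℚ_[p]} {k : ℕ}
    (hx : ‖x‖ ≤ (p : ℝ) ^ k) :
    ‖χ x - 1‖ ≤ rootGap p k := by
  by_cases h : ‖x‖ < 1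
  · rw [hχ.eq_one x h, sub_self, norm_zero]; exact (rootGap_pos k).le
  · obtain ⟨l, hl⟩ := exists_norm_eq_pow (not_lt.mp h)
    rw [hχ.norm_sub_one hl]
    rw [hl] at hx
    exact rootGap_mono ((pow_le_pow_iff_right₀ one_lt_prime_real).mp hx)
theorem norm_sub_one_le_one (hχ : IsNormalizedChar χ) (x : ℚ_[p]) : ‖χ x - 1‖ ≤ 1 := by
  obtain ⟨k, hk⟩ := pow_unbounded_of_one_lt ‖x‖ (one_lt_prime_real (p := p))
  exact (hχ.norm_sub_one_le hk.le).trans (rootGap_lt_one k).le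

theorem norm_eq_one (hχ : IsNormalizedChar χ) (x : ℚ_[p]) : ‖χ x‖ = 1 := by
  have h : ∀ x, ‖χ x‖ ≤ 1 := fun x => by
    rw [← sub_add_cancel (χ x) 1]
    exact (IsUltrametricDist.norm_add_le_max _ _).trans
      (max_le (hχ.norm_sub_one_le_one x) norm_one.le)
  refine le_antisymm (h x) ?_
  have h1 : ‖χ x‖ * ‖χ (-x)‖ = 1 := by
    rw [← norm_mul, ← AddChar.map_add_eq_mul, add_neg_cancel, AddChar.map_zero_eq_one, norm_one]
  rw [← h1]
  exact mul_le_of_le_one_right (norm_nonneg _) (h _)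

/-- Finitely many points of the ball of radius `p ^ (K + j)`, at most `p ^ K` of them, such that
the product of the `χ (x - y) - 1` is small on that whole ball. -/
theorem exists_zeros (hχ : IsNormalizedChar χ) (j K : ℕ) :
    ∃ Z : Multiset ℚ_[p], Z.card = p ^ K ∧ (∀ y ∈ Z, ‖y‖ ≤ (p : ℝ) ^ (K + j)) ∧
      ∀ x, ‖x‖ ≤ (p : ℝ) ^ (K + j) →
        ‖(Z.map fun y => χ (x - y) - 1).prod‖ ≤ ((p : ℝ) ^ (-(1 / (p : ℝ) ^ (j + 1)))) ^ K := by
  have hp := one_lt_prime_real (p := p)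
  have hp0 : (p : ℝ) ≠ 0 := by linarith
  induction K with
  | zero =>
    refine ⟨{0}, by simp, by simp, fun x _ => ?_⟩
    simpa using hχ.norm_sub_one_le_one x
  | succ K ih =>
    obtain ⟨Z, hcard, hZ, hprod⟩ := ih
    set E := K + 1 + j with hE
    set q : ℚ_[p] := (p : ℚ_[p]) ^ E with hq
    have hqn : ‖q‖ = ((p : ℝ) ^ E)⁻¹ := by rw [hq, norm_pow, Padic.norm_p, inv_pow]
    have hq0 : q ≠ 0 := by rw [← norm_pos_iff, hqn]; positivity
    have hnat : ∀ i : ℕ, ‖(i : ℚ_[p])‖ ≤ 1 := fun i => by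
      simpa using Padic.norm_int_le_one (p := p) (i : ℤ)
    have hiq : ∀ i : ℕ, ‖(i : ℚ_[p]) / q‖ ≤ (p : ℝ) ^ E := fun i => by
      rw [norm_div, hqn, div_inv_eq_mul]
      exact mul_le_of_le_one_left (by positivity) (hnat i)
    -- The ball of radius `p ^ E` is the union of the `p` translates by `i / q` of the ball of
    -- radius `p ^ (E - 1)`; each receives a copy of `Z`.
    refine ⟨(Multiset.range p).bind fun i => Z.map fun y => (i : ℚ_[p]) / q + y, ?_, ?_, ?_⟩
    · simp [Multiset.card_bind, hcard, pow_succ']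
    · intro y hy
      rw [Multiset.mem_bind] at hy
      obtain ⟨i, -, hy⟩ := hy
      obtain ⟨z, hz, rfl⟩ := Multiset.mem_map.mp hy
      refine (IsUltrametricDist.norm_add_le_max _ _).trans (max_le (hiq i) ?_)
      exact (hZ z hz).trans (pow_le_pow_right₀ hp.le (by omega))
    · intro x hx
      have hxq : ‖x * q‖ ≤ 1 := by
        rw [norm_mul, hqn, ← div_eq_mul_inv, div_le_one (by positivity)]; exact hx
      obtain ⟨i₀, hi₀, hxi⟩ := exists_nat_norm_sub_le 1 hxq
      rw [pow_one] at hi₀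
      have hshift : ∀ i : ℕ, (Multiset.map (fun y => χ (x - y) - 1)
          (Z.map fun y => (i : ℚ_[p]) / q + y)) =
          Z.map fun y => χ (x - i / q - y) - 1 := by
        intro i
        rw [Multiset.map_map]
        simp [sub_sub]
      have hx₀ : ‖x - i₀ / q‖ ≤ (p : ℝ) ^ (K + j) := by
        have : x - i₀ / q = (x * q - i₀) / q := by field_simp
        rw [this, norm_div, hqn, div_inv_eq_mul]
        refine (mul_le_mul_of_nonneg_right hxi (by positivity)).trans_eq ?_
        rw [hE, show K + 1 + j = K + j + 1 by ring, pow_succ]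
        simp
        field_simp
      -- The copy in the translate containing `x` is handled by induction. Every point of the other
      -- copies is at distance exactly `p ^ E` from `x`.
      have hne : ∀ i ∈ (Finset.range p).erase i₀,
          ‖(Multiset.map (fun y => χ (x - y) - 1) (Z.map fun y => (i : ℚ_[p]) / q + y)).prod‖ =
            rootGap p E ^ p ^ K := by
        intro i hi
        rw [Finset.mem_erase, Finset.mem_range] at hi
        have hii : ‖(i₀ : ℚ_[p]) - i‖ = 1 := by
          have h1 : ‖(((i₀ : ℤ) - i : ℤ) : ℚ_[p])‖ = 1 := by
            refine le_antisymm (Padic.norm_int_le_one _) (not_lt.mp fun h => ?_)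
            rw [Padic.norm_intCast_lt_one_iff] at h
            have h2 := Int.eq_zero_of_abs_lt_dvd h (by rw [abs_lt]; omega)
            omega
          simpa using h1
        have hfar : ∀ y ∈ Z, ‖x - i / q - y‖ = (p : ℝ) ^ E := by
          intro y hy
          have e : x - i / q - y = (i₀ - i) / q + (x - i₀ / q - y) := by ring
          have e1 : ‖((i₀ : ℚ_[p]) - i) / q‖ = (p : ℝ) ^ E := by
            rw [norm_div, hii, hqn, one_div, inv_inv]
          have e2 : ‖x - i₀ / q - y‖ < (p : ℝ) ^ E := by
            rw [sub_eq_add_neg]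
            refine lt_of_le_of_lt ((IsUltrametricDist.norm_add_le_max _ _).trans
              (max_le hx₀ ?_)) (pow_lt_pow_right₀ hp (show K + j < E by omega))
            rw [norm_neg]; exact hZ y hy
          rw [e, IsUltrametricDist.norm_add_eq_max_of_norm_ne_norm (by rw [e1]; exact e2.ne'),
            e1, max_eq_left e2.le]
        rw [hshift, ← hcard, norm_multiset_map_prod,
          Multiset.map_congr rfl fun y hy => hχ.norm_sub_one (hfar y hy), Multiset.map_const',
          Multiset.prod_replicate]
      rw [Multiset.map_bind, Multiset.prod_bind]
      change ‖∏ i ∈ Finset.range p, _‖ ≤ _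
      rw [norm_prod,
        ← Finset.mul_prod_erase _ _ (Finset.mem_range.mpr hi₀), Finset.prod_congr rfl hne,
        Finset.prod_const, hshift, Finset.card_erase_of_mem (Finset.mem_range.mpr hi₀),
        Finset.card_range, pow_succ]
      refine mul_le_mul (hprod _ hx₀) (le_of_eq ?_) 
        (pow_nonneg (pow_nonneg (rootGap_pos E).le _) _) (by positivity)
      -- The `(p - 1) p ^ K` distant points contribute the exponent `(p - 1) p ^ K / ((p - 1) p ^ (K
      -- + 1 + j)) = 1 / p ^ (j + 1)`: each induction step gains the same factor.
      rw [← pow_mul, rootGap_pow]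
      congr 1
      push_cast [Nat.cast_sub (Fact.out : p.Prime).one_lt.le]
      have : (p : ℝ) - 1 ≠ 0 := by linarith
      rw [hE, show K + 1 + j = K + (j + 1) by ring, pow_add (p : ℝ) K]
      field_simp

/-- Finitely many points of the annulus `p ^ E < ‖x‖ ≤ p ^ (n + E)`, where `E = K + j`, such that
the product of the `χ (x - y) - 1` is small on that annulus. -/
theorem exists_zeros_annulus (hχ : IsNormalizedChar χ) (n j K : ℕ) :
    ∃ Z : Multiset ℚ_[p], Z.card ≤ p ^ (n + K) ∧ (∀ y ∈ Z, (p : ℝ) ^ (K + j) < ‖y‖) ∧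
      ∀ x, (p : ℝ) ^ (K + j) < ‖x‖ → ‖x‖ ≤ (p : ℝ) ^ (n + (K + j)) →
        ‖(Z.map fun y => χ (x - y) - 1).prod‖ ≤ ((p : ℝ) ^ (-(1 / (p : ℝ) ^ (j + 1)))) ^ K := by
  have hp := one_lt_prime_real (p := p)
  have hp0 : (p : ℝ) ≠ 0 := by linarith
  obtain ⟨Z, hcard, hZ, hprod⟩ := hχ.exists_zeros j K
  set E := K + j with hE
  set q : ℚ_[p] := (p : ℚ_[p]) ^ (n + E) with hq
  have hqn : ‖q‖ = ((p : ℝ) ^ (n + E))⁻¹ := by rw [hq, norm_pow, Padic.norm_p, inv_pow]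
  have hq0 : q ≠ 0 := by rw [← norm_pos_iff, hqn]; positivity
  have hpE : (p : ℝ) ^ E = (p : ℝ) ^ (-n : ℤ) * (p : ℝ) ^ (n + E) := by
    rw [pow_add _ n E, zpow_neg, zpow_natCast, inv_mul_cancel_left₀ (pow_ne_zero _ hp0)]
  have hscale : ∀ z : ℚ_[p], ‖z‖ ≤ (p : ℝ) ^ (-n : ℤ) → ‖z / q‖ ≤ (p : ℝ) ^ E := by
    intro z hz
    rw [norm_div, hqn, div_inv_eq_mul]
    exact (mul_le_mul_of_nonneg_right hz (by positivity)).trans_eq hpE.symm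
  -- The outer ball consists of `p ^ n` translates of the inner one. The shift `a + 1` omits the
  -- translate at 0, which is the inner ball itself.
  refine ⟨(Multiset.range (p ^ n - 1)).bind fun a => Z.map fun y => ((a + 1 : ℕ) : ℚ_[p]) / q + y,
    ?_, ?_, ?_⟩
  · simp only [Multiset.card_bind, Function.comp_def, Multiset.card_map, hcard, Multiset.map_const',
      Multiset.card_range, Multiset.sum_replicate, smul_eq_mul]
    rw [pow_add]
    exact Nat.mul_le_mul_right _ (Nat.sub_le _ _)
  · intro y hy
    rw [Multiset.mem_bind] at hy
    obtain ⟨a, ha, hy⟩ := hy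
    obtain ⟨z, hz, rfl⟩ := Multiset.mem_map.mp hy
    rw [Multiset.mem_range] at ha
    have h1 : (p : ℝ) ^ (-n : ℤ) < ‖((a + 1 : ℕ) : ℚ_[p])‖ := by
      refine not_le.mp fun h => ?_
      have h2 : ‖(((a + 1 : ℕ) : ℤ) : ℚ_[p])‖ ≤ (p : ℝ) ^ (-n : ℤ) := by
        rw [Int.cast_natCast]; exact h
      rw [Padic.norm_int_le_pow_iff_dvd] at h2
      have := Nat.le_of_dvd (Nat.succ_pos a) (by exact_mod_cast h2)
      omega
    have h2 : (p : ℝ) ^ E < ‖((a + 1 : ℕ) : ℚ_[p]) / q‖ := by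
      rw [norm_div, hqn, div_inv_eq_mul]
      refine lt_of_eq_of_lt hpE (mul_lt_mul_of_pos_right h1 (by positivity))
    have h3 := (hZ z hz).trans_lt h2
    rw [IsUltrametricDist.norm_add_eq_max_of_norm_ne_norm h3.ne', max_eq_left h3.le]
    exact h2
  · intro x hx1 hx2
    have hxq : ‖x * q‖ ≤ 1 := by
      rw [norm_mul, hqn, ← div_eq_mul_inv, div_le_one (by positivity)]; exact hx2
    obtain ⟨a, ha, hxa⟩ := exists_nat_norm_sub_le n hxq
    obtain ⟨a, rfl⟩ : ∃ a', a = a' + 1 := by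
      refine Nat.exists_eq_succ_of_ne_zero fun h => ?_
      rw [h, Nat.cast_zero, sub_zero] at hxa
      have := hscale _ hxa
      rw [mul_div_cancel_right₀ _ hq0] at this
      linarith
    have hx₀ : ‖x - ((a + 1 : ℕ) : ℚ_[p]) / q‖ ≤ (p : ℝ) ^ E := by
      have : x - ((a + 1 : ℕ) : ℚ_[p]) / q = (x * q - ((a + 1 : ℕ) : ℚ_[p])) / q := by field_simp
      rw [this]
      exact hscale _ hxa
    have hmem : a ∈ Finset.range (p ^ n - 1) := Finset.mem_range.mpr (by omega)
    rw [Multiset.map_bind, Multiset.prod_bind]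
    change ‖∏ i ∈ Finset.range (p ^ n - 1), _‖ ≤ _
    rw [norm_prod, ← Finset.mul_prod_erase _ _ hmem]
    -- Only the copy of `Z` in the translate containing `x` is needed for smallness; all other
    -- factors are at most 1.
    refine (mul_le_of_le_one_right (norm_nonneg _) (Finset.prod_le_one
      (fun i _ => norm_nonneg _) fun i _ =>
        norm_multiset_map_prod_le_one fun y _ => hχ.norm_sub_one_le_one _)).trans ?_
    rw [Multiset.map_map]
    simpa only [Function.comp_def, ← sub_sub] using hprod _ hx₀

end IsNormalizedChar

end CharNorm

/-! ### Combinations of characters with bounded coefficients, and polynomials in `χ x - 1`. -/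

section CharLattice

variable {p : ℕ} [Fact p.Prime]

/-- The `ℂ_p`-valued functions on a `ℚ_p`-vector space which are linear combinations, with
coefficients of absolute value at most `ρ`, of the characters `χ ∘ ℓ`, `ℓ` a linear form. -/
def charLattice (χ : AddChar ℚ_[p] ℂ_[p]) (V : Type*) [AddCommGroup V] [Module ℚ_[p] V] (ρ : ℝ) :
    AddSubgroup (V → ℂ_[p]) :=
  AddSubgroup.closure
    {φ | ∃ (c : ℂ_[p]) (l : Module.Dual ℚ_[p] V), ‖c‖ ≤ ρ ∧ φ = fun x => c * χ (l x)}

variable {χ : AddChar ℚ_[p] ℂ_[p]} {V V' : Type*} [AddCommGroup V] [Module ℚ_[p] V]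
  [AddCommGroup V'] [Module ℚ_[p] V'] {ρ ρ' : ℝ}

theorem char_mem_charLattice (l : Module.Dual ℚ_[p] V) :
    (fun x => χ (l x)) ∈ charLattice χ V 1 :=
  AddSubgroup.subset_closure ⟨1, l, norm_one.le, by simp⟩

theorem const_mem_charLattice {c : ℂ_[p]} (hc : ‖c‖ ≤ ρ) :
    (fun _ => c) ∈ charLattice χ V ρ :=
  AddSubgroup.subset_closure ⟨c, 0, hc, by simp⟩

/-- Products of characters are characters, and adding terms never enlarges a coefficient bound in
the ultrametric setting, so the bounds simply multiply. -/
theorem mul_mem_charLattice {φ φ' : V → ℂ_[p]} (h : φ ∈ charLattice χ V ρ)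
    (h' : φ' ∈ charLattice χ V ρ') : φ * φ' ∈ charLattice χ V (ρ * ρ') := by
  induction h using AddSubgroup.closure_induction with
  | mem φ hφ =>
    obtain ⟨c, l, hc, rfl⟩ := hφ
    induction h' using AddSubgroup.closure_induction with
    | mem φ' hφ' =>
      obtain ⟨c', l', hc', rfl⟩ := hφ'
      refine AddSubgroup.subset_closure ⟨c * c', l + l', ?_, ?_⟩
      · rw [norm_mul]
        exact mul_le_mul hc hc' (norm_nonneg _) ((norm_nonneg _).trans hc)
      · ext x
        simp only [Pi.mul_apply, LinearMap.add_apply, AddChar.map_add_eq_mul]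
        ring
    | zero => rw [mul_zero]; exact zero_mem _
    | add a b _ _ ha hb => rw [mul_add]; exact add_mem ha hb
    | neg a _ ha => rw [mul_neg]; exact neg_mem ha
  | zero => rw [zero_mul]; exact zero_mem _
  | add a b _ _ ha hb => rw [add_mul]; exact add_mem ha hb
  | neg a _ ha => rw [neg_mul]; exact neg_mem ha

theorem norm_le_of_mem_charLattice (hχ : ∀ x, ‖χ x‖ = 1) (hρ : 0 ≤ ρ) {φ : V → ℂ_[p]}
    (h : φ ∈ charLattice χ V ρ) (x : V) : ‖φ x‖ ≤ ρ := by
  induction h using AddSubgroup.closure_induction with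
  | mem φ hφ =>
    obtain ⟨c, l, hc, rfl⟩ := hφ
    rwa [norm_mul, hχ, mul_one]
  | zero => simpa using hρ
  | add a b _ _ ha hb => exact (IsUltrametricDist.norm_add_le_max _ _).trans (max_le ha hb)
  | neg a _ ha => rw [Pi.neg_apply, norm_neg]; exact ha

theorem comp_mem_charLattice (f : V' →ₗ[ℚ_[p]] V) {φ : V → ℂ_[p]}
    (h : φ ∈ charLattice χ V ρ) : φ ∘ f ∈ charLattice χ V' ρ := by
  induction h using AddSubgroup.closure_induction with
  | mem φ hφ =>
    obtain ⟨c, l, hc, rfl⟩ := hφ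
    exact AddSubgroup.subset_closure ⟨c, l ∘ₗ f, hc, rfl⟩
  | zero => exact zero_mem _
  | add a b _ _ ha hb => exact add_mem ha hb
  | neg a _ ha => exact neg_mem ha

theorem pow_mem_charLattice {φ : V → ℂ_[p]} (h : φ ∈ charLattice χ V ρ) (n : ℕ) :
    φ ^ n ∈ charLattice χ V (ρ ^ n) := by
  induction n with
  | zero => exact const_mem_charLattice norm_one.le
  | succ n ih => rw [pow_succ, pow_succ]; exact mul_mem_charLattice ih h

theorem prod_mem_charLattice {ι : Type*} (s : Finset ι) {φ : ι → V → ℂ_[p]}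
    (h : ∀ i ∈ s, φ i ∈ charLattice χ V ρ) : ∏ i ∈ s, φ i ∈ charLattice χ V (ρ ^ s.card) := by
  classical
  induction s using Finset.induction_on with
  | empty => exact const_mem_charLattice norm_one.le
  | insert a s ha ih =>
    rw [Finset.prod_insert ha, Finset.card_insert_of_notMem ha, pow_succ']
    exact mul_mem_charLattice (h a (by simp)) (ih fun i hi => h i (Finset.mem_insert_of_mem hi))

theorem multisetProd_mem_charLattice (hχ : ∀ x, ‖χ x‖ = 1) (Z : Multiset ℚ_[p]) :
    (fun x => (Z.map fun y => χ (x - y) - 1).prod) ∈ charLattice χ ℚ_[p] 1 := by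
  induction Z using Multiset.induction_on with
  | empty => simpa using const_mem_charLattice (χ := χ) (V := ℚ_[p]) (c := 1) norm_one.le
  | cons a s ih =>
    have h1 : (fun x => χ (x - a) - 1) ∈ charLattice χ ℚ_[p] 1 := by
      refine sub_mem (AddSubgroup.subset_closure ⟨χ (-a), LinearMap.id, (hχ _).le, ?_⟩)
        (const_mem_charLattice norm_one.le)
      ext x
      rw [sub_eq_neg_add, AddChar.map_add_eq_mul]; rfl
    have h2 := mul_mem_charLattice h1 ih
    rw [one_mul] at h2
    convert h2 using 1
    ext x
    simp

/-- A polynomial with constant coefficient `1` is invertible modulo powers of `X`. -/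
theorem exists_truncated_inverse {A : Type*} [CommRing A] {Q : Polynomial A}
    (hQ : Q.coeff 0 = 1) (k : ℕ) :
    ∃ (c : ℕ → A) (D : Polynomial A),
      Q * ∑ i ∈ Finset.range (k + 1), Polynomial.C (c i) * Polynomial.X ^ i =
        1 + Polynomial.X ^ (k + 1) * D := by
  nontriviality A
  obtain ⟨D₁, hD₁⟩ : (Polynomial.X : Polynomial A) ∣ 1 - Q := by
    rw [Polynomial.X_dvd_iff]; simp [hQ]
  -- The geometric sum inverts `Q` modulo `X ^ (k + 1)` because `X` divides `1 - Q`. Reducing it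
  -- modulo `X ^ (k + 1)` bounds its degree by `k`, which later bounds the powers of `τ` in
  -- denominators.
  set P := ∑ i ∈ Finset.range (k + 1), (1 - Q) ^ i with hP
  have h1 : Q * P = 1 - Polynomial.X ^ (k + 1) * D₁ ^ (k + 1) := by
    have := mul_neg_geom_sum (1 - Q) (k + 1)
    rw [sub_sub_cancel, ← hP] at this
    rw [this, hD₁, mul_pow]
  set M : Polynomial A := Polynomial.X ^ (k + 1) with hM
  have hdeg : (P %ₘ M).natDegree < k + 1 := by
    have := Polynomial.natDegree_modByMonic_lt P (Polynomial.monic_X_pow (R := A) (k + 1))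
      (fun h => by simpa using congrArg Polynomial.natDegree h)
    rwa [Polynomial.natDegree_X_pow] at this
  refine ⟨(P %ₘ M).coeff, -D₁ ^ (k + 1) - Q * (P /ₘ M), ?_⟩
  rw [← Polynomial.as_sum_range_C_mul_X_pow' _ hdeg]
  have h2 := Polynomial.modByMonic_add_div P M
  linear_combination h1 + Q * h2

/-- The closed unit ball of `ℂ_p`. -/
def unitBallSubring (p : ℕ) [Fact p.Prime] : Subring ℂ_[p] where
  carrier := {z | ‖z‖ ≤ 1}
  mul_mem' {a b} ha hb := by
    change ‖a * b‖ ≤ 1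
    rw [norm_mul]; exact mul_le_one₀ ha (norm_nonneg _) hb
  one_mem' := norm_one.le
  add_mem' {a b} ha hb := (IsUltrametricDist.norm_add_le_max a b).trans (max_le ha hb)
  zero_mem' := by simp
  neg_mem' {a} ha := by change ‖-a‖ ≤ 1; rw [norm_neg]; exact ha

theorem norm_aeval_le_one (D : Polynomial (unitBallSubring p)) {s : ℂ_[p]} (hs : ‖s‖ ≤ 1) :
    ‖Polynomial.aeval s D‖ ≤ 1 := by
  rw [Polynomial.aeval_eq_sum_range]
  refine IsUltrametricDist.norm_sum_le_of_forall_le_of_nonneg zero_le_one fun i _ => ?_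
  rw [Subring.smul_def, smul_eq_mul, norm_mul, norm_pow]
  exact mul_le_one₀ (D.coeff i).2 (by positivity) (pow_le_one₀ (norm_nonneg _) hs)

/-- With `s = (χ x - 1) / τ`, each factor is `χ (x - a) - 1 = (χ (-a) - 1) (1 + c s)` where `c = τ χ
(-a) / (χ (-a) - 1)`. The lower bound on `χ (-a) - 1` makes `c` integral. -/
theorem exists_polynomial_of_zeros (hχ : ∀ x, ‖χ x‖ = 1) {τ : ℂ_[p]} (hτ : τ ≠ 0)
    (Z : Multiset ℚ_[p]) (hZ : ∀ y ∈ Z, ‖τ‖ ≤ ‖χ (-y) - 1‖) :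
    ∃ Q : Polynomial (unitBallSubring p), Q.coeff 0 = 1 ∧ ∀ x,
      (Z.map fun y => χ (x - y) - 1).prod =
        (Z.map fun y => χ (0 - y) - 1).prod * Polynomial.aeval ((χ x - 1) / τ) Q := by
  induction Z using Multiset.induction_on with
  | empty => exact ⟨1, by simp, by simp⟩
  | cons a Z ih =>
    obtain ⟨Q, hQ, h⟩ := ih fun y hy => hZ y (Multiset.mem_cons_of_mem hy)
    have ha := hZ a (by simp)
    have ha0 : χ (-a) - 1 ≠ 0 := by
      rw [← norm_pos_iff]; exact (norm_pos_iff.mpr hτ).trans_le ha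
    let c : unitBallSubring p := ⟨τ * χ (-a) / (χ (-a) - 1), by
      change ‖_‖ ≤ 1
      rw [norm_div, norm_mul, hχ, mul_one]
      exact div_le_one_of_le₀ ha (norm_nonneg _)⟩
    refine ⟨(1 + Polynomial.C c * Polynomial.X) * Q, by simp [Polynomial.mul_coeff_zero, hQ], ?_⟩
    intro x
    have hc : algebraMap (unitBallSubring p) ℂ_[p] c = τ * χ (-a) / (χ (-a) - 1) := rfl
    rw [Multiset.map_cons, Multiset.prod_cons, h x, Multiset.map_cons, Multiset.prod_cons, map_mul]
    simp only [map_add, map_mul, map_one, Polynomial.aeval_C, Polynomial.aeval_X, hc, zero_sub,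
      sub_eq_add_neg x a, AddChar.map_add_eq_mul χ x (-a)]
    field_simp
    ring

end CharLattice

/-! ### The one-dimensional approximate cut-off function. -/

section Multiplier

variable {p : ℕ} [Fact p.Prime]

theorem exists_nat_le_rpow (p n : ℕ) [Fact p.Prime] {r : ℝ} (hr1 : r < 1) :
    ∃ j : ℕ, r ≤ (p : ℝ) ^ (-((p : ℝ) ^ n / (p : ℝ) ^ j)) := by
  have hp := one_lt_prime_real (p := p)
  have h1 : Filter.Tendsto (fun j : ℕ => -((p : ℝ) ^ n / (p : ℝ) ^ j)) Filter.atTop (nhds 0) := by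
    have := (tendsto_const_nhds (x := (p : ℝ) ^ n)).div_atTop
      (tendsto_pow_atTop_atTop_of_one_lt hp)
    simpa using this.neg
  have h2 : Filter.Tendsto (fun j : ℕ => (p : ℝ) ^ (-((p : ℝ) ^ n / (p : ℝ) ^ j)))
      Filter.atTop (nhds 1) := by
    have := (Real.continuous_const_rpow (prime_real_pos (p := p)).ne').tendsto 0
    rw [Real.rpow_zero] at this
    exact this.comp h1
  exact (h2.eventually_const_le hr1).exists

/-- For an inner ball of radius `p ^ E`, `E` large, and an outer ball `p ^ n` times larger, there
is a combination of characters, with coefficients of absolute value at most `R ^ 2`, which is close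
to `1` on the inner ball and small on the rest of the outer ball. The quality `R⁻¹` of the
approximation does not depend on `n`. -/
theorem IsNormalizedChar.exists_multiplier {χ : AddChar ℚ_[p] ℂ_[p]} (hχ : IsNormalizedChar χ)
    (n : ℕ) {R : ℝ} (hR : 1 < R) :
    ∃ E : ℕ, ∃ φ ∈ charLattice χ ℚ_[p] (R ^ 2), ∀ x, ‖x‖ ≤ (p : ℝ) ^ (n + E) →
      (‖x‖ ≤ (p : ℝ) ^ E → ‖φ x - 1‖ ≤ R⁻¹) ∧ ((p : ℝ) ^ E < ‖x‖ → ‖φ x‖ ≤ R⁻¹) := by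
  have hp := one_lt_prime_real (p := p)
  have hR0 : 0 < R := by linarith
  have hRi : R⁻¹ < 1 := inv_lt_one_of_one_lt₀ hR
  -- The order of choices matters: `j` alone, given `n`, keeps the product at the origin above
  -- `R⁻¹`, whatever `K` is. Then `K` is taken large enough to make the product at most `R⁻¹ ^ 3` on
  -- the annulus.
  obtain ⟨j, hj⟩ := exists_nat_le_rpow p n hRi
  obtain ⟨K, hK⟩ := exists_pow_lt_of_lt_one (show 0 < (R⁻¹) ^ 3 by positivity)
    (show (p : ℝ) ^ (-(1 / (p : ℝ) ^ (j + 1))) < 1 from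
      Real.rpow_lt_one_of_one_lt_of_neg hp (neg_lt_zero.mpr (by positivity)))
  obtain ⟨Z, hcard, hZ, hprod⟩ := hχ.exists_zeros_annulus n j K
  set E := K + j with hE
  refine ⟨E, ?_⟩
  set b := rootGap p (E + 1) with hb
  have hb0 : 0 < b := rootGap_pos _
  have hb1 : b < 1 := rootGap_lt_one _
  -- There are at most `p ^ (n + K)` factors, each at least `b` in absolute value at the origin.
  -- Since `E + 1 = K + j + 1`, the powers of `p ^ K` cancel in the exponent.
  have hbZ : R⁻¹ ≤ b ^ Z.card := by
    refine hj.trans ((?_ : _ ≤ b ^ p ^ (n + K)).trans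
      (pow_le_pow_of_le_one hb0.le hb1.le hcard))
    rw [hb, rootGap_pow]
    refine Real.rpow_le_rpow_of_exponent_le hp.le (neg_le_neg ?_)
    rw [div_le_div_iff₀ (mul_pos (by linarith) (by positivity)) (by positivity), hE]
    push_cast
    have h1 : (1 : ℝ) ≤ ((p : ℝ) - 1) * p := by
      have : (2 : ℝ) ≤ p := by exact_mod_cast (Fact.out : p.Prime).two_le
      nlinarith
    calc (p : ℝ) ^ (n + K) * (p : ℝ) ^ j = (p : ℝ) ^ n * (1 * (p : ℝ) ^ (K + j)) := by ring
      _ ≤ (p : ℝ) ^ n * ((((p : ℝ) - 1) * p) * (p : ℝ) ^ (K + j)) := by gcongr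
      _ = _ := by ring
  -- Its absolute value `b` is the least one taken by `χ y - 1` outside the inner ball, as
  -- `exists_polynomial_of_zeros` requires.
  set τ : ℂ_[p] := χ (((p : ℚ_[p]) ^ (E + 1))⁻¹) - 1 with hτ
  have hτn : ‖τ‖ = b := hχ.norm_sub_one (by rw [norm_inv, norm_pow, Padic.norm_p, inv_pow, inv_inv])
  have hτ0 : τ ≠ 0 := by rw [← norm_pos_iff, hτn]; exact hb0
  have hZ' : ∀ y ∈ Z, ‖τ‖ ≤ ‖χ (-y) - 1‖ := by
    intro y hy
    have h1 := hZ y hy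
    obtain ⟨l, hl⟩ := exists_norm_eq_pow ((one_le_pow₀ hp.le).trans h1.le)
    rw [hτn, hχ.norm_sub_one (x := -y) (by rw [norm_neg, hl])]
    rw [hl, pow_lt_pow_iff_right₀ hp] at h1
    exact rootGap_mono h1
  obtain ⟨Q, hQ0, hQ⟩ := exists_polynomial_of_zeros hχ.norm_eq_one hτ0 Z hZ'
  -- The degree `k` satisfies `b ^ (k + 1) < R⁻¹ ≤ b ^ k`: the first inequality bounds the
  -- truncation error, the second the coefficients `c i / τ ^ i`.
  obtain ⟨k, hk1, hk2⟩ := exists_nat_pow_near_of_lt_one (inv_pos.mpr hR0) hRi.le hb0 hb1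
  obtain ⟨c, D, hD⟩ := exists_truncated_inverse hQ0 k
  set w := (Z.map fun y => χ (0 - y) - 1).prod with hw
  have hwn : R⁻¹ ≤ ‖w‖ := by
    refine hbZ.trans (pow_card_le_norm_multiset_map_prod hb0.le fun y hy => ?_)
    rw [zero_sub, ← hτn]; exact hZ' y hy
  have hw0 : w ≠ 0 := by rw [← norm_pos_iff]; exact (inv_pos.mpr hR0).trans_le hwn
  have hwi : ‖w⁻¹‖ ≤ R := by
    rw [norm_inv]; exact inv_le_of_inv_le₀ hR0 hwn
  set g : ℚ_[p] → ℂ_[p] := fun x => (Z.map fun y => χ (x - y) - 1).prod with hg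
  set P : ℚ_[p] → ℂ_[p] := ∑ i ∈ Finset.range (k + 1),
    ((fun _ => (c i : ℂ_[p]) / τ ^ i) * (fun x => χ x - 1) ^ i) with hP
  have hPmem : P ∈ charLattice χ ℚ_[p] R := by
    refine sum_mem fun i hi => ?_
    have h1 : (fun x => χ x - 1) ∈ charLattice χ ℚ_[p] 1 :=
      sub_mem (char_mem_charLattice LinearMap.id) (const_mem_charLattice norm_one.le)
    have h2 : ‖(c i : ℂ_[p]) / τ ^ i‖ ≤ R := by
      rw [norm_div, norm_pow, hτn, div_le_iff₀ (by positivity)]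
      refine (c i).2.trans ?_
      rw [← inv_mul_le_iff₀ hR0, mul_one]
      exact hk2.trans (pow_le_pow_of_le_one hb0.le hb1.le
        (Nat.lt_succ_iff.mp (Finset.mem_range.mp hi)))
    have h3 := mul_mem_charLattice (const_mem_charLattice (χ := χ) (V := ℚ_[p]) h2)
      (pow_mem_charLattice h1 i)
    rwa [one_pow, mul_one] at h3
  have hPaeval : ∀ x, P x = Polynomial.aeval ((χ x - 1) / τ)
      (∑ i ∈ Finset.range (k + 1), Polynomial.C (c i) * Polynomial.X ^ i) := by
    intro x
    simp only [hP, Finset.sum_apply, Pi.mul_apply, Pi.pow_apply, map_sum, map_mul, map_pow,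
      Polynomial.aeval_C, Polynomial.aeval_X]
    refine Finset.sum_congr rfl fun i _ => ?_
    change _ = (c i : ℂ_[p]) * _
    rw [div_pow]; ring
  -- The coefficient bounds are `R` for `w⁻¹`, 1 for `g` and `R` for `P`. On the annulus the product
  -- is at most `R * R⁻¹ ^ 3 * R`, which explains the cube.
  refine ⟨(fun _ => w⁻¹) * g * P, ?_, fun x hx => ⟨fun hxE => ?_, fun hxE => ?_⟩⟩
  · have h1 := mul_mem_charLattice (mul_mem_charLattice
      (const_mem_charLattice (χ := χ) (V := ℚ_[p]) hwi)
      (multisetProd_mem_charLattice hχ.norm_eq_one Z)) hPmem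
    rwa [mul_one, ← sq] at h1
  · set s := (χ x - 1) / τ with hs
    have hsn : ‖s‖ ≤ b := by
      rw [hs, norm_div, hτn, div_le_iff₀ hb0]
      refine (hχ.norm_sub_one_le hxE).trans ?_
      -- On the inner ball `‖χ x - 1‖ ≤ b ^ p ≤ b ^ 2`, so one power of `b` survives the division by
      -- `τ`.
      rw [← rootGap_succ_pow, ← sq]
      exact pow_le_pow_of_le_one hb0.le hb1.le (Fact.out : p.Prime).two_le
    have h1 : ((fun _ => w⁻¹) * g * P : ℚ_[p] → ℂ_[p]) x - 1 = s ^ (k + 1) * Polynomial.aeval s D := by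
      have h2 := congrArg (Polynomial.aeval s) hD
      rw [map_mul, ← hPaeval, map_add, map_mul, map_pow, map_one, Polynomial.aeval_X] at h2
      simp only [Pi.mul_apply, hg, hQ x]
      rw [inv_mul_cancel_left₀ hw0, h2]
      ring
    rw [h1, norm_mul, norm_pow]
    refine (mul_le_of_le_one_right (by positivity)
      (norm_aeval_le_one D (hsn.trans hb1.le))).trans ?_
    exact (pow_le_pow_left₀ (norm_nonneg _) hsn _).trans hk1.le
  · simp only [Pi.mul_apply, norm_mul]
    have h1 := (hprod x hxE hx).trans hK.le
    have h2 := norm_le_of_mem_charLattice hχ.norm_eq_one hR0.le hPmem x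
    calc ‖w⁻¹‖ * ‖g x‖ * ‖P x‖ ≤ R * (R⁻¹) ^ 3 * R := by gcongr
      _ = R⁻¹ := by field_simp

end Multiplier

/-! ### Cut-off functions for arbitrary radii and in several variables. -/

section VectorMultiplier

variable {p : ℕ} [Fact p.Prime]

/-- Two rescalings reduce this to a normalized character and an inner radius `p ^ E`: one of the
character by `s`, and one of the variable by `q = p ^ (-(E + m + 1))`. Both are absorbed in the
linear forms, so coefficients do not change. -/
theorem SmoothChar.exists_multiplier (ψ : SmoothChar p) (m A : ℕ) {R : ℝ} (hR : 1 < R) :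
    ∃ φ ∈ charLattice ψ.toAddChar ℚ_[p] (R ^ 2), ∀ x, ‖x‖ ≤ (p : ℝ) ^ A →
      (‖x‖ < (p : ℝ) ^ (-m : ℤ) → ‖φ x - 1‖ ≤ R⁻¹) ∧
        (¬ ‖x‖ < (p : ℝ) ^ (-m : ℤ) → ‖φ x‖ ≤ R⁻¹) := by
  have hp0 := prime_real_pos (p := p)
  obtain ⟨s, hs, hs'⟩ := exists_sep ψ (one_ne_zero (α := ℚ_[p]))
  rw [norm_one] at hs'
  have hχ : IsNormalizedChar (AddChar.mulShift ψ.toAddChar s) := ⟨hs', hs⟩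
  obtain ⟨E, φ, hφ, h⟩ := hχ.exists_multiplier (A + m + 1) hR
  set q : ℚ_[p] := ((p : ℚ_[p]) ^ (E + m + 1))⁻¹ with hq
  have hqn : ‖q‖ = (p : ℝ) ^ (E + m + 1) := by
    rw [hq, norm_inv, norm_pow, Padic.norm_p, inv_pow, inv_inv]
  have hle : charLattice (AddChar.mulShift ψ.toAddChar s) ℚ_[p] (R ^ 2) ≤
      charLattice ψ.toAddChar ℚ_[p] (R ^ 2) :=
    AddSubgroup.closure_mono fun _ ⟨c, l, hc, e⟩ => ⟨c, s • l, hc, e⟩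
  refine ⟨_, comp_mem_charLattice (LinearMap.mulLeft ℚ_[p] q) (hle hφ), fun x hx => ?_⟩
  have hqx : ‖q * x‖ = (p : ℝ) ^ (E + m + 1) * ‖x‖ := by rw [norm_mul, hqn]
  have hiff : ‖x‖ < (p : ℝ) ^ (-m : ℤ) ↔ ‖q * x‖ ≤ (p : ℝ) ^ E := by
    -- The value group is discrete: the open ball of radius `p ^ (-m)` is the closed ball of radius
    -- `p ^ (-m - 1)`, hence the extra 1 in `q` and in `A + m + 1`.
    have h1 := Padic.norm_le_pow_iff_norm_lt_pow_add_one x (-m - 1 : ℤ)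
    rw [sub_add_cancel] at h1
    have h2 : (p : ℝ) ^ E = (p : ℝ) ^ (E + m + 1) * (p : ℝ) ^ (-m - 1 : ℤ) := by
      rw [← zpow_natCast, ← zpow_natCast, ← zpow_add₀ hp0.ne']
      congr 1
      push_cast
      ring
    rw [← h1, hqx, h2, mul_le_mul_iff_right₀ (by positivity)]
  have h1 := h (q * x) (by
    rw [hqx]
    calc (p : ℝ) ^ (E + m + 1) * ‖x‖ ≤ (p : ℝ) ^ (E + m + 1) * (p : ℝ) ^ A := by gcongr
      _ = _ := by ring)
  exact ⟨fun hx' => h1.1 (hiff.mp hx'), fun hx' => h1.2 (not_le.mp fun h2 => hx' (hiff.mpr h2))⟩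

theorem norm_prod_sub_one_le {ι : Type*} (s : Finset ι) {a : ι → ℂ_[p]} {r : ℝ} (hr0 : 0 ≤ r)
    (hr : r ≤ 1) (h : ∀ i ∈ s, ‖a i - 1‖ ≤ r) : ‖∏ i ∈ s, a i - 1‖ ≤ r := by
  classical
  induction s using Finset.induction_on with
  | empty => simpa using hr0
  | insert i s hi ih =>
    have h1 := ih fun j hj => h j (Finset.mem_insert_of_mem hj)
    have h2 := h i (Finset.mem_insert_self _ _)
    have h3 : ‖a i‖ ≤ 1 := by
      rw [← sub_add_cancel (a i) 1]
      exact (IsUltrametricDist.norm_add_le_max _ _).trans (max_le (h2.trans hr) norm_one.le)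
    rw [Finset.prod_insert hi,
      show a i * ∏ j ∈ s, a j - 1 = a i * (∏ j ∈ s, a j - 1) + (a i - 1) by ring]
    refine (IsUltrametricDist.norm_add_le_max _ _).trans (max_le ?_ h2)
    rw [norm_mul]
    exact (mul_le_of_le_one_left (norm_nonneg _) h3).trans h1

/-- A combination of characters of `ℚ_p^d`, close to `1` on a small ball and small on the rest of a
large ball. -/
theorem SmoothChar.exists_multiplier_pi (ψ : SmoothChar p) (d m A : ℕ) {R : ℝ} (hR : 1 < R) :
    ∃ φ ∈ charLattice ψ.toAddChar (Fin d → ℚ_[p]) ((R ^ 2) ^ d), ∀ x, ‖x‖ ≤ (p : ℝ) ^ A →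
      (‖x‖ < (p : ℝ) ^ (-m : ℤ) → ‖φ x - 1‖ ≤ R⁻¹) ∧
        (¬ ‖x‖ < (p : ℝ) ^ (-m : ℤ) → ‖φ x‖ ≤ R⁻¹) := by
  have hp0 := prime_real_pos (p := p)
  have hRi : R⁻¹ < 1 := inv_lt_one_of_one_lt₀ hR
  have hRi0 : 0 < R⁻¹ := inv_pos.mpr (by linarith)
  obtain ⟨φ, hφ, h⟩ := ψ.exists_multiplier m A hR
  -- For the max norm a ball is a product of balls. Outside it one coordinate factor is small, and
  -- the others are at most 1.
  refine ⟨∏ i : Fin d, φ ∘ LinearMap.proj (R := ℚ_[p]) i, ?_, fun x hx => ?_⟩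
  · have := prod_mem_charLattice (V := Fin d → ℚ_[p]) Finset.univ
      fun i _ => comp_mem_charLattice (LinearMap.proj (R := ℚ_[p]) (φ := fun _ : Fin d => ℚ_[p]) i) hφ
    rwa [Finset.card_univ, Fintype.card_fin] at this
  have hi : ∀ i, ‖x i‖ ≤ (p : ℝ) ^ A := fun i => (norm_le_pi_norm x i).trans hx
  have hprod : (∏ i : Fin d, φ ∘ LinearMap.proj (R := ℚ_[p]) i : (Fin d → ℚ_[p]) → ℂ_[p]) x =
      ∏ i, φ (x i) := by
    rw [Finset.prod_apply]; rfl
  rw [hprod]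
  refine ⟨fun hxm => ?_, fun hxm => ?_⟩
  · refine norm_prod_sub_one_le _ hRi0.le hRi.le fun i _ => (h _ (hi i)).1 ?_
    exact (norm_le_pi_norm x i).trans_lt hxm
  · rw [pi_norm_lt_iff (by positivity)] at hxm
    push Not at hxm
    obtain ⟨i, hxi⟩ := hxm
    have hone : ∀ i, ‖φ (x i)‖ ≤ 1 := by
      intro i
      by_cases hc : ‖x i‖ < (p : ℝ) ^ (-m : ℤ)
      · rw [← sub_add_cancel (φ (x i)) 1]
        exact (IsUltrametricDist.norm_add_le_max _ _).trans
          (max_le (((h _ (hi i)).1 hc).trans hRi.le) norm_one.le)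
      · exact ((h _ (hi i)).2 hc).trans hRi.le
    rw [norm_prod, ← Finset.mul_prod_erase _ _ (Finset.mem_univ i)]
    exact (mul_le_of_le_one_right (norm_nonneg _) (Finset.prod_le_one (fun _ _ => norm_nonneg _)
      fun j _ => hone j)).trans ((h _ (hi i)).2 (not_lt.mpr hxi))

end VectorMultiplier

/-! ### Combinations of translates of a vector with bounded coefficients. -/

section OrbitLattice

variable {p : ℕ} [Fact p.Prime] {G : Type*} [Group G]

/-- The linear combinations of the translates of `v`, with coefficients of absolute value at most
`ρ`. -/
def orbitLattice {B : Type*} [AddCommGroup B] [Module ℂ_[p] B] (π : Representation ℂ_[p] G B)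
    (v : B) (ρ : ℝ) : AddSubgroup B :=
  AddSubgroup.closure {w | ∃ (c : ℂ_[p]) (g : G), ‖c‖ ≤ ρ ∧ w = c • π g v}

section Algebra

variable {B B' : Type*} [AddCommGroup B] [Module ℂ_[p] B] [AddCommGroup B'] [Module ℂ_[p] B']
  {π : Representation ℂ_[p] G B} {π' : Representation ℂ_[p] G B'} {ρ ρ' : ℝ} {v w : B}

theorem orbitLattice_mono (h : ρ ≤ ρ') : orbitLattice π v ρ ≤ orbitLattice π v ρ' :=
  AddSubgroup.closure_mono fun _ ⟨c, g, hc, e⟩ => ⟨c, g, hc.trans h, e⟩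

theorem smul_apply_mem_orbitLattice {c : ℂ_[p]} (hc : ‖c‖ ≤ ρ) (g : G) :
    c • π g v ∈ orbitLattice π v ρ :=
  AddSubgroup.subset_closure ⟨c, g, hc, rfl⟩

/-- Equivariance is only asked up to a change of group element, so that intertwining operators
twisted by a symplectic automorphism are allowed. -/
theorem map_mem_orbitLattice (F : B →ₗ[ℂ_[p]] B')
    (hF : ∀ g, ∃ g', F (π g v) = π' g' (F v)) (h : w ∈ orbitLattice π v ρ) :
    F w ∈ orbitLattice π' (F v) ρ := by
  induction h using AddSubgroup.closure_induction with
  | mem w hw =>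
    obtain ⟨c, g, hc, rfl⟩ := hw
    obtain ⟨g', hg'⟩ := hF g
    rw [map_smul, hg']
    exact smul_apply_mem_orbitLattice hc g'
  | zero => rw [map_zero]; exact zero_mem _
  | add a b _ _ ha hb => rw [map_add]; exact add_mem ha hb
  | neg a _ ha => rw [map_neg]; exact neg_mem ha

theorem smul_mem_orbitLattice (c : ℂ_[p]) (g : G) (h : w ∈ orbitLattice π v ρ) :
    c • π g w ∈ orbitLattice π v (‖c‖ * ρ) := by
  induction h using AddSubgroup.closure_induction with
  | mem w hw =>
    obtain ⟨c', g', hc', rfl⟩ := hw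
    rw [map_smul, smul_smul, ← Module.End.mul_apply, ← map_mul]
    refine smul_apply_mem_orbitLattice ?_ _
    rw [norm_mul]
    exact mul_le_mul_of_nonneg_left hc' (norm_nonneg _)
  | zero => rw [map_zero, smul_zero]; exact zero_mem _
  | add a b _ _ ha hb => rw [map_add, smul_add]; exact add_mem ha hb
  | neg a _ ha => rw [map_neg, smul_neg]; exact neg_mem ha

theorem orbitLattice_smul_le (c : ℂ_[p]) (g : G) :
    orbitLattice π (c • π g v) ρ ≤ orbitLattice π v (‖c‖ * ρ) := by
  refine (AddSubgroup.closure_le _).mpr ?_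
  rintro _ ⟨c', g', hc', rfl⟩
  rw [map_smul, smul_smul, ← Module.End.mul_apply, ← map_mul]
  refine smul_apply_mem_orbitLattice ?_ _
  rw [norm_mul, mul_comm]
  exact mul_le_mul_of_nonneg_left hc' (norm_nonneg _)

end Algebra

/-- Invariance bounds every single term, and the ultrametric inequality makes the number of terms
irrelevant. This is how coefficient bounds become norm bounds. -/
theorem IsBanachRep.norm_le_of_mem_orbitLattice {B : Type*} [NormedAddCommGroup B]
    [NormedSpace ℂ_[p] B] {π : Representation ℂ_[p] G B} (hπ : IsBanachRep π) {ρ : ℝ} (hρ : 0 ≤ ρ)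
    {v w : B} (h : w ∈ orbitLattice π v ρ) : ‖w‖ ≤ ρ * ‖v‖ := by
  induction h using AddSubgroup.closure_induction with
  | mem w hw =>
    obtain ⟨c, g, hc, rfl⟩ := hw
    rw [norm_smul, hπ.invariant]
    exact mul_le_mul_of_nonneg_right hc (norm_nonneg _)
  | zero => rw [norm_zero]; positivity
  | add a b _ _ ha hb => exact (hπ.norm_add_le_max _ _).trans (max_le ha hb)
  | neg a _ ha => rwa [norm_neg]

end OrbitLattice

/-! ### Strong irreducibility of the Schrödinger representation in the sup norm. -/

section Density

open scoped Matrix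

variable {p : ℕ} [Fact p.Prime] {d : ℕ}

/-- Every linear form is `x ↦ b ⬝ᵥ x`, and `modul b` acts as multiplication by `ψ (b ⬝ᵥ x)`;
combinations of characters thus act as multipliers without loss in the coefficients. -/
theorem exists_mem_orbitLattice_mul (ψ : SmoothChar p) (f : Schw p d) {ρ : ℝ}
    {φ : (Fin d → ℚ_[p]) → ℂ_[p]} (hφ : φ ∈ charLattice ψ.toAddChar (Fin d → ℚ_[p]) ρ) :
    ∃ l ∈ orbitLattice (schrodinger ψ d) f ρ, ∀ x, l.1 x = φ x * f.1 x := by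
  induction hφ using AddSubgroup.closure_induction with
  | mem φ hφ =>
    obtain ⟨c, l, hc, rfl⟩ := hφ
    refine ⟨c • schrodinger ψ d (modul fun i => l (Pi.single i 1)) f,
      smul_apply_mem_orbitLattice hc _, fun x => ?_⟩
    have h1 : l x = (fun i => l (Pi.single i 1)) ⬝ᵥ x := by
      rw [LinearMap.pi_apply_eq_sum_univ l x]
      simp only [dotProduct, smul_eq_mul]
      refine Finset.sum_congr rfl fun i _ => ?_
      rw [mul_comm]
      congr 2
      ext j
      simp [Pi.single_apply, eq_comm]
    change c * (schrodinger ψ d _ f).1 x = _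
    rw [schrodinger_modul, ← h1, mul_assoc]
  | zero => exact ⟨0, zero_mem _, fun x => (zero_mul _).symm⟩
  | add a b _ _ ha hb =>
    obtain ⟨l, hl, h⟩ := ha
    obtain ⟨l', hl', h'⟩ := hb
    refine ⟨l + l', add_mem hl hl', fun x => ?_⟩
    change l.1 x + l'.1 x = (a x + b x) * f.1 x
    rw [h, h', add_mul]
  | neg a _ ha =>
    obtain ⟨l, hl, h⟩ := ha
    refine ⟨-l, neg_mem hl, fun x => ?_⟩
    change -l.1 x = -a x * f.1 x
    rw [h, neg_mul]

/-- Balls of equal radius are disjoint or equal. Subtracting `f c` times the ball at `c` erases `f`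
there and leaves its other values alone, so the bound `M` persists through the induction. -/
theorem mem_addSubgroup_of_balls (W : AddSubgroup (Schw p d)) {ε M : ℝ}
    (hW : ∀ c (a : ℂ_[p]), ‖a‖ ≤ M → a • ballFn c ε ∈ W) (s : Finset (Fin d → ℚ_[p])) :
    ∀ f : Schw p d, (∀ x, ‖f.1 x‖ ≤ M) → (∀ x y, ‖y‖ < ε → f.1 (x + y) = f.1 x) →
      (∀ x, f.1 x ≠ 0 → ∃ c ∈ s, ‖x - c‖ < ε) → f ∈ W := by
  classical
  induction s using Finset.induction_on with
  | empty =>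
    intro f _ _ hs
    have : f = 0 := by
      ext x
      by_contra h
      obtain ⟨c, hc, _⟩ := hs x h
      simp at hc
    rw [this]; exact W.zero_mem
  | insert c s hc ih =>
    intro f hM hf hs
    have hval : ∀ x, (f - f.1 c • ballFn c ε).1 x = if ‖x - c‖ < ε then 0 else f.1 x := by
      intro x
      change f.1 x - f.1 c * (ballFn c ε).1 x = _
      split_ifs with h
      · have := hf c (x - c) h
        rw [add_sub_cancel] at this
        rw [ballFn_of_mem h, this, mul_one, sub_self]
      · rw [ballFn_of_notMem h, mul_zero, sub_zero]
    have hsub : f - f.1 c • ballFn c ε ∈ W := by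
      apply ih
      · intro x
        rw [hval]
        split_ifs
        · rw [norm_zero]; exact (norm_nonneg _).trans (hM x)
        · exact hM x
      · intro x y hy
        have hiff : ‖x + y - c‖ < ε ↔ ‖x - c‖ < ε :=
          ⟨fun h => norm_sub_lt_trans (y := x + y) (by simpa using hy) h,
            fun h => norm_sub_lt_trans (y := x) (by simpa using hy) h⟩
        simp only [hval, hiff, hf x y hy]
      · intro x hx
        rw [hval] at hx
        split_ifs at hx with h
        · exact absurd rfl hx
        · obtain ⟨c', hc', h'⟩ := hs x hx
          rcases Finset.mem_insert.mp hc' with rfl | hmem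
          · exact absurd h' h
          · exact ⟨c', hmem, h'⟩
    simpa using W.add_mem hsub (hW c (f.1 c) (hM c))

theorem supNorm_le {f : Schw p d} {M : ℝ} (h : ∀ x, ‖f.1 x‖ ≤ M) : supNorm f ≤ M := ciSup_le h

theorem exists_norm_eq_supNorm (f : Schw p d) : ∃ x, ‖f.1 x‖ = supNorm f := by
  obtain ⟨x, hx⟩ := f.2.1.continuous.norm.exists_forall_ge_of_hasCompactSupport
    (f.2.2.comp_left (g := fun z => ‖z‖) norm_zero)
  exact ⟨x, le_antisymm (norm_le_supNorm f x) (supNorm_le hx)⟩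

theorem supNorm_pos {f : Schw p d} (hf : f ≠ 0) : 0 < supNorm f :=
  lt_of_le_of_ne (supNorm_nonneg f) fun h => hf (supNorm_eq_zero h.symm)

/-- Small balls are approximated by combinations of the translates of a given function. -/
theorem exists_mem_orbitLattice_ballFn (ψ : SmoothChar p) {f : Schw p d} (hf : f ≠ 0) {m : ℕ}
    (hm : ∀ x y, ‖y‖ < (p : ℝ) ^ (-m : ℤ) → f.1 (x + y) = f.1 x) {R : ℝ} (hR : 1 < R)
    (a : ℂ_[p]) (c : Fin d → ℚ_[p]) :
    ∃ l ∈ orbitLattice (schrodinger ψ d) f (‖a‖ * ((supNorm f)⁻¹ * (R ^ 2) ^ d)),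
      supNorm (a • ballFn c ((p : ℝ) ^ (-m : ℤ)) - l) ≤ ‖a‖ * R⁻¹ := by
  have hp := one_lt_prime_real (p := p)
  obtain ⟨x₀, hx₀⟩ := exists_norm_eq_supNorm f
  have hfx₀ : f.1 x₀ ≠ 0 := by rw [← norm_pos_iff, hx₀]; exact supNorm_pos hf
  have hRi : R⁻¹ < 1 := inv_lt_one_of_one_lt₀ hR
  have hRi0 : 0 < R⁻¹ := inv_pos.mpr (by linarith)
  -- Because the supremum is attained at `x₀`, the function `f₁` has value 1 at the origin and is
  -- bounded by 1, at the exact cost `(supNorm f)⁻¹`.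
  set f₁ : Schw p d := (f.1 x₀)⁻¹ • schrodinger ψ d (transl x₀) f with hf₁
  have hf₁x : ∀ x, f₁.1 x = (f.1 x₀)⁻¹ * f.1 (x + x₀) := by
    intro x
    change (f.1 x₀)⁻¹ * (schrodinger ψ d (transl x₀) f).1 x = _
    rw [schrodinger_transl]
  obtain ⟨r, hr⟩ := f₁.2.2.isCompact.isBounded.exists_norm_le
  obtain ⟨A, hA⟩ := pow_unbounded_of_one_lt r hp
  -- The multiplier is only controlled on the ball of radius `p ^ A`, which is chosen to contain the
  -- support of `f₁`.
  obtain ⟨φ, hφ, hφx⟩ := ψ.exists_multiplier_pi d m A hR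
  obtain ⟨l₁, hl₁, hl₁x⟩ := exists_mem_orbitLattice_mul ψ f₁ hφ
  have hball : schrodinger ψ d (transl (-c)) (ballFn 0 ((p : ℝ) ^ (-m : ℤ))) =
      ballFn c ((p : ℝ) ^ (-m : ℤ)) := by
    ext x
    rw [schrodinger_transl]
    by_cases h : ‖x - c‖ < (p : ℝ) ^ (-m : ℤ)
    · rw [ballFn_of_mem h, ballFn_of_mem (by simpa [← sub_eq_add_neg] using h)]
    · rw [ballFn_of_notMem h, ballFn_of_notMem (by simpa [← sub_eq_add_neg] using h)]
  refine ⟨a • schrodinger ψ d (transl (-c)) l₁, ?_, ?_⟩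
  · have h1 := orbitLattice_smul_le _ _ hl₁
    rw [norm_inv, hx₀] at h1
    exact smul_mem_orbitLattice a _ h1
  · have h1 : a • ballFn c ((p : ℝ) ^ (-m : ℤ)) - a • schrodinger ψ d (transl (-c)) l₁ =
        a • schrodinger ψ d (transl (-c)) (ballFn 0 ((p : ℝ) ^ (-m : ℤ)) - l₁) := by
      rw [map_sub, hball]
      exact (smul_sub a _ _).symm
    rw [h1, supNorm_smul, supNorm_schrodinger]
    refine mul_le_mul_of_nonneg_left (supNorm_le fun x => ?_) (norm_nonneg _)
    change ‖(ballFn 0 _).1 x - l₁.1 x‖ ≤ _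
    rw [hl₁x]
    by_cases hx : ‖x‖ < (p : ℝ) ^ (-m : ℤ)
    · have h1 : f₁.1 x = 1 := by
        rw [hf₁x, add_comm, hm x₀ x hx, inv_mul_cancel₀ hfx₀]
      have hxA : ‖x‖ ≤ (p : ℝ) ^ A := hx.le.trans
        ((zpow_le_one_of_nonpos₀ hp.le (by omega)).trans (one_le_pow₀ hp.le))
      rw [ballFn_of_mem (by simpa using hx), h1, mul_one, norm_sub_rev]
      exact (hφx x hxA).1 hx
    · rw [ballFn_of_notMem (by simpa using hx), zero_sub, norm_neg, norm_mul]
      by_cases hfx : f₁.1 x = 0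
      · rw [hfx, norm_zero, mul_zero]; exact hRi0.le
      · have hxA : ‖x‖ ≤ (p : ℝ) ^ A := (hr x (subset_tsupport _ hfx)).trans hA.le
        have h1 : ‖f₁.1 x‖ ≤ 1 := by
          rw [hf₁x, norm_mul, norm_inv, inv_mul_le_iff₀ (norm_pos_iff.mpr hfx₀), mul_one, hx₀]
          exact norm_le_supNorm f _
        exact (mul_le_of_le_one_right (norm_nonneg _) h1).trans ((hφx x hxA).2 hx)

/-- The functions approximable this well form an additive group, by the ultrametric inequality. It
contains all multiples of small balls by scalars of size at most `supNorm h`, hence `h`. -/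
theorem exists_mem_orbitLattice_of_ne_zero (ψ : SmoothChar p) {f : Schw p d} (hf : f ≠ 0)
    (h : Schw p d) {R : ℝ} (hR : 1 < R) :
    ∃ l ∈ orbitLattice (schrodinger ψ d) f (supNorm h * ((supNorm f)⁻¹ * (R ^ 2) ^ d)),
      supNorm (h - l) ≤ supNorm h * R⁻¹ := by
  have hp := one_lt_prime_real (p := p)
  have hR0 : 0 < R := by linarith
  obtain ⟨ε₁, hε₁, hf₁⟩ := exists_invariant f
  obtain ⟨ε₂, hε₂, hh₂⟩ := exists_invariant h
  obtain ⟨m, hm⟩ := exists_pow_lt_of_lt_one (lt_min hε₁ hε₂) (inv_lt_one_of_one_lt₀ hp)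
  rw [inv_pow, ← zpow_natCast, ← zpow_neg] at hm
  set L := orbitLattice (schrodinger ψ d) f (supNorm h * ((supNorm f)⁻¹ * (R ^ 2) ^ d)) with hL
  let W : AddSubgroup (Schw p d) :=
    { carrier := {w | ∃ l ∈ L, supNorm (w - l) ≤ supNorm h * R⁻¹}
      zero_mem' := ⟨0, zero_mem _, by
        rw [sub_zero, supNorm_zero]
        exact mul_nonneg (supNorm_nonneg h) (inv_nonneg.mpr hR0.le)⟩
      add_mem' := by
        rintro a b ⟨l, hl, h1⟩ ⟨l', hl', h2⟩
        refine ⟨l + l', add_mem hl hl', ?_⟩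
        rw [add_sub_add_comm]
        exact (supNorm_add_le _ _).trans (max_le h1 h2)
      neg_mem' := by
        rintro a ⟨l, hl, h1⟩
        refine ⟨-l, neg_mem hl, ?_⟩
        rwa [← neg_sub', ← neg_one_smul ℂ_[p], supNorm_smul, norm_neg, norm_one, one_mul] }
  obtain ⟨s, hs⟩ := exists_cover h (show 0 < (p : ℝ) ^ (-m : ℤ) by positivity)
  refine mem_addSubgroup_of_balls W (ε := (p : ℝ) ^ (-m : ℤ)) (M := supNorm h) ?_ s h
    (norm_le_supNorm h) (fun x y hy => hh₂ x y (hy.trans (hm.trans_le (min_le_right _ _)))) hs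
  intro c a ha
  obtain ⟨l, hl, hl'⟩ := exists_mem_orbitLattice_ballFn ψ hf
    (fun x y hy => hf₁ x y (hy.trans (hm.trans_le (min_le_left _ _)))) hR a c
  refine ⟨l, orbitLattice_mono ?_ hl, hl'.trans ?_⟩
  · exact mul_le_mul_of_nonneg_right ha
      (mul_nonneg (inv_nonneg.mpr (supNorm_nonneg f)) (by positivity))
  · exact mul_le_mul_of_nonneg_right ha (inv_nonneg.mpr hR0.le)

/-- If `‖h‖ < ρ ‖f‖` in the sup norm, then `h` is a limit of combinations of the translates of `f`
with coefficients of absolute value at most `ρ`. -/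
theorem exists_mem_orbitLattice_supNorm_lt (ψ : SmoothChar p) {f : Schw p d} (hf : f ≠ 0)
    (h : Schw p d) {ρ : ℝ} (hρ : supNorm h < ρ * supNorm f) {ε : ℝ} (hε : 0 < ε) :
    ∃ l ∈ orbitLattice (schrodinger ψ d) f ρ, supNorm (h - l) < ε := by
  have hf0 := supNorm_pos hf
  -- At `R = 1` the inequality is the hypothesis, which is strict; by continuity it holds slightly
  -- to the right of 1. Here it is essential that the loss `R ^ (2 d)` can be made arbitrarily close
  -- to 1.
  obtain ⟨R, hR, hRρ⟩ : ∃ R : ℝ, 1 < R ∧ supNorm h * ((supNorm f)⁻¹ * (R ^ 2) ^ d) < ρ := by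
    have hc : Continuous fun R : ℝ => supNorm h * ((supNorm f)⁻¹ * (R ^ 2) ^ d) := by fun_prop
    have h1 : ∀ᶠ R in nhds (1 : ℝ), supNorm h * ((supNorm f)⁻¹ * (R ^ 2) ^ d) < ρ := by
      refine hc.tendsto 1 |>.eventually_lt_const ?_
      rw [one_pow, one_pow, mul_one, ← div_eq_mul_inv, div_lt_iff₀ hf0]
      exact hρ
    have h2 := h1.filter_mono (nhdsWithin_le_nhds (s := Set.Ioi 1))
    exact (h2.and self_mem_nhdsWithin).exists.imp fun _ h => ⟨h.2, h.1⟩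
  have hR0 : 0 < R := by linarith
  -- Each approximation improves the error only by `R⁻¹`, but it can be iterated on the remainder:
  -- remainders never exceed `supNorm h`, so every correction has coefficients within `ρ`.
  have key : ∀ n : ℕ, ∃ l ∈ orbitLattice (schrodinger ψ d) f ρ,
      supNorm (h - l) ≤ supNorm h * R⁻¹ ^ n := by
    intro n
    induction n with
    | zero => exact ⟨0, zero_mem _, by simp⟩
    | succ n ih =>
      obtain ⟨l, hl, hln⟩ := ih
      obtain ⟨l', hl', hln'⟩ := exists_mem_orbitLattice_of_ne_zero ψ hf (h - l) hR
      refine ⟨l + l', add_mem hl (orbitLattice_mono ?_ hl'), ?_⟩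
      · refine le_trans (mul_le_mul_of_nonneg_right ?_ ?_) hRρ.le
        · exact hln.trans (mul_le_of_le_one_right (supNorm_nonneg h)
            (pow_le_one₀ (inv_nonneg.mpr hR0.le) (inv_le_one_of_one_le₀ hR.le)))
        · positivity
      · rw [← sub_sub, pow_succ, ← mul_assoc]
        exact hln'.trans (mul_le_mul_of_nonneg_right hln (inv_nonneg.mpr hR0.le))
  have hlim : Filter.Tendsto (fun n : ℕ => supNorm h * R⁻¹ ^ n) Filter.atTop (nhds 0) := by
    simpa using (tendsto_pow_atTop_nhds_zero_of_lt_one (inv_nonneg.mpr hR0.le)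
      (inv_lt_one_of_one_lt₀ hR)).const_mul (supNorm h)
  obtain ⟨n, hn⟩ := (hlim.eventually_lt_const hε).exists
  obtain ⟨l, hl, hln⟩ := key n
  exact ⟨l, hl, hln.trans_lt hn⟩

end Density

/-! ### Transfer to the norms `‖·‖_α` and to the completions. -/

section AlphaDensity

variable {p : ℕ} [Fact p.Prime] {d : ℕ}

/-- The operator `T_g` is a homothety onto the sup norm, and its inverse permutes translates through
the automorphism `Heis.act`, so it carries orbit lattices to orbit lattices. -/
theorem exists_mem_orbitLattice_alphaNorm_lt (ψ : SmoothChar p) (α : Grassmannian p d)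
    {f : Schw p d} (hf : f ≠ 0) (h : Schw p d) {ρ : ℝ}
    (hρ : alphaNorm ψ α h < ρ * alphaNorm ψ α f) {ε : ℝ} (hε : 0 < ε) :
    ∃ l ∈ orbitLattice (schrodinger ψ d) f ρ, alphaNorm ψ α (h - l) < ε := by
  set T := weilOp ψ α.rep with hT
  have hc := supNorm_weilOp_pos ψ α.rep
  rw [alphaNorm, alphaNorm, ← mul_div_assoc, div_lt_div_iff_of_pos_right hc] at hρ
  obtain ⟨l, hl, hlε⟩ := exists_mem_orbitLattice_supNorm_lt ψ (f := T f)
    (fun h0 => hf (T.map_eq_zero_iff.mp h0)) (T h) hρ (mul_pos hε hc)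
  refine ⟨T.symm l, ?_, ?_⟩
  · have h1 := map_mem_orbitLattice (π' := schrodinger ψ d) T.symm.toLinearMap (fun g =>
      ⟨Heis.act α.rep g, by
        change T.symm (schrodinger ψ d g (T f)) = schrodinger ψ d _ (T.symm (T f))
        rw [weilOp_spec ψ α.rep g f, T.symm_apply_apply, T.symm_apply_apply]⟩) hl
    change T.symm l ∈ orbitLattice _ (T.symm (T f)) ρ at h1
    rwa [T.symm_apply_apply] at h1
  · rwa [alphaNorm, div_lt_iff₀ hc, map_sub, ← hT, T.apply_symm_apply]

/-- The inclusion of `𝒮(ℚ_p^d)` into its completion. -/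
def toAlphaCompletion (ψ : SmoothChar p) (α : Grassmannian p d) :
    Schw p d →ₗ[ℂ_[p]] AlphaCompletion ψ α :=
  (UniformSpace.Completion.toComplₗᵢ (𝕜 := ℂ_[p]) (E := SchwAlpha ψ α)).toLinearMap ∘ₗ
    (toAlpha ψ α).toLinearMap

variable {G : Type*} [Group G] {B B' : Type*} [NormedAddCommGroup B] [NormedSpace ℂ_[p] B]
  [NormedAddCommGroup B'] [NormedSpace ℂ_[p] B'] {π : Representation ℂ_[p] G B}
  {π' : Representation ℂ_[p] G B'}

theorem IsBanachRep.exists_mem_orbitLattice_norm_sub_le (hπ : IsBanachRep π) {ρ : ℝ} (hρ : 0 ≤ ρ)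
    {u v l : B} (hl : l ∈ orbitLattice π v ρ) :
    ∃ l' ∈ orbitLattice π u ρ, ‖l - l'‖ ≤ ρ * ‖v - u‖ := by
  induction hl using AddSubgroup.closure_induction with
  | mem w hw =>
    obtain ⟨c, g, hc, rfl⟩ := hw
    refine ⟨c • π g u, smul_apply_mem_orbitLattice hc g, ?_⟩
    rw [← smul_sub, ← map_sub, norm_smul, hπ.invariant]
    exact mul_le_mul_of_nonneg_right hc (norm_nonneg _)
  | zero => exact ⟨0, zero_mem _, by rw [sub_zero, norm_zero]; positivity⟩
  | add a b _ _ ha hb =>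
    obtain ⟨l, hl, h⟩ := ha
    obtain ⟨l', hl', h'⟩ := hb
    refine ⟨l + l', add_mem hl hl', ?_⟩
    rw [add_sub_add_comm]
    exact (hπ.norm_add_le_max _ _).trans (max_le h h')
  | neg a _ ha =>
    obtain ⟨l, hl, h⟩ := ha
    exact ⟨-l, neg_mem hl, by rwa [← neg_sub', norm_neg]⟩

/-- Approximations found in the target lift to the source with the same coefficients, which is what
controls the norms of preimages. -/
theorem exists_preimage_mem_orbitLattice {F : B →L[ℂ_[p]] B'}
    (hF : ∀ g v, F (π g v) = π' g (F v)) {v : B} {ρ : ℝ} {l : B'}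
    (hl : l ∈ orbitLattice π' (F v) ρ) : ∃ l' ∈ orbitLattice π v ρ, F l' = l := by
  induction hl using AddSubgroup.closure_induction with
  | mem w hw =>
    obtain ⟨c, g, hc, rfl⟩ := hw
    exact ⟨c • π g v, smul_apply_mem_orbitLattice hc g, by rw [map_smul, hF]⟩
  | zero => exact ⟨0, zero_mem _, map_zero F⟩
  | add a b _ _ ha hb =>
    obtain ⟨l, hl, rfl⟩ := ha
    obtain ⟨l', hl', rfl⟩ := hb
    exact ⟨l + l', add_mem hl hl', map_add F l l'⟩
  | neg a _ ha =>
    obtain ⟨l, hl, rfl⟩ := ha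
    exact ⟨-l, neg_mem hl, map_neg F l⟩

/-- A strong form of topological irreducibility: if `‖w‖ < ρ ‖u‖`, then `w` is a limit of
combinations of the translates of `u` with coefficients of absolute value at most `ρ`. -/
def IsStronglyIrreducible (π : Representation ℂ_[p] G B) : Prop :=
  ∀ (u w : B) (ρ : ℝ), ‖w‖ < ρ * ‖u‖ → ∀ ε > 0, ∃ l ∈ orbitLattice π u ρ, ‖w - l‖ < ε

theorem isStronglyIrreducible_alphaRep (ψ : SmoothChar p) (α : Grassmannian p d) :
    IsStronglyIrreducible (alphaRep ψ α) := by
  intro u w ρ hρ ε hε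
  have hπ := isBanachRep_alphaRep ψ α
  have hρ0 : 0 < ρ := pos_of_mul_pos_left ((norm_nonneg w).trans_lt hρ) (norm_nonneg u)
  -- The margin `δ` must absorb the error in approximating `w`, the error from replacing the
  -- translates of `f` by those of `u`, and keep the strict inequality for the approximants.
  obtain ⟨δ, hδ, hδ1, hδ2, hδ3⟩ : ∃ δ > 0, δ < ε ∧ ρ * δ < ε ∧ ‖w‖ + δ < ρ * (‖u‖ - δ) := by
    have h1 : ∀ᶠ δ in nhds (0 : ℝ), δ < ε ∧ ρ * δ < ε ∧ ‖w‖ + δ < ρ * (‖u‖ - δ) := by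
      refine Filter.Eventually.and (eventually_lt_nhds hε) (Filter.Eventually.and ?_ ?_)
      · exact ((continuous_const.mul continuous_id).tendsto' (0 : ℝ) 0
          (by simp)).eventually_lt_const hε
      · have hc : Continuous fun δ : ℝ => ρ * (‖u‖ - δ) - (‖w‖ + δ) := by fun_prop
        filter_upwards [(hc.tendsto 0).eventually_const_lt
          (show 0 < ρ * (‖u‖ - 0) - (‖w‖ + 0) by simpa using hρ)] with δ hδ
        linarith
    have h2 := h1.filter_mono (nhdsWithin_le_nhds (s := Set.Ioi 0))
    exact (h2.and self_mem_nhdsWithin).exists.imp fun _ h => ⟨h.2, h.1⟩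
  have happrox : ∀ v : AlphaCompletion ψ α, ∃ f : Schw p d, ‖v - toAlphaCompletion ψ α f‖ < δ := by
    intro v
    obtain ⟨f, hf⟩ := UniformSpace.Completion.denseRange_coe.exists_dist_lt v hδ
    exact ⟨f, by rw [← dist_eq_norm]; exact hf⟩
  obtain ⟨f, hf⟩ := happrox u
  obtain ⟨h, hh⟩ := happrox w
  have hnorm : ∀ f, ‖toAlphaCompletion ψ α f‖ = alphaNorm ψ α f := fun f =>
    UniformSpace.Completion.norm_coe (toAlpha ψ α f)
  have h1 : ‖toAlphaCompletion ψ α h‖ < ρ * ‖toAlphaCompletion ψ α f‖ := by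
    have e1 := norm_le_norm_add_norm_sub w (toAlphaCompletion ψ α h)
    have e2 := norm_le_norm_add_norm_sub' u (toAlphaCompletion ψ α f)
    have e3 : ρ * (‖u‖ - δ) ≤ ρ * ‖toAlphaCompletion ψ α f‖ :=
      mul_le_mul_of_nonneg_left (by linarith) hρ0.le
    linarith
  rw [hnorm, hnorm] at h1
  have hf0 : f ≠ 0 := by
    rintro rfl
    rw [alphaNorm_zero, mul_zero] at h1
    exact absurd h1 (not_lt.mpr (alphaNorm_nonneg ψ α h))
  obtain ⟨l, hl, hlε⟩ := exists_mem_orbitLattice_alphaNorm_lt ψ α hf0 h h1 hε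
  obtain ⟨l', hl', hll'⟩ := hπ.exists_mem_orbitLattice_norm_sub_le hρ0.le (u := u)
    (map_mem_orbitLattice (π' := alphaRep ψ α) (toAlphaCompletion ψ α)
      (fun g => ⟨g, (alphaRep_coe ψ α g f).symm⟩) hl)
  refine ⟨l', hl', ?_⟩
  rw [← sub_add_sub_cancel w (toAlphaCompletion ψ α l) l',
    ← sub_add_sub_cancel w (toAlphaCompletion ψ α h) (toAlphaCompletion ψ α l)]
  refine (hπ.norm_add_le_max _ _).trans_lt (max_lt ((hπ.norm_add_le_max _ _).trans_lt
    (max_lt (hh.trans hδ1) ?_)) (hll'.trans_lt ?_))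
  · rwa [← map_sub, hnorm]
  · rw [norm_sub_rev]
    exact (mul_le_mul_of_nonneg_left hf.le hρ0.le).trans_lt hδ2

end AlphaDensity

/-! ### Equivariant maps from or to a strongly irreducible representation are homotheties. -/

section Rigidity

variable {p : ℕ} [Fact p.Prime] {G : Type*} [Group G] {B B' : Type*} [NormedAddCommGroup B]
  [NormedSpace ℂ_[p] B] [NormedAddCommGroup B'] [NormedSpace ℂ_[p] B']
  {π : Representation ℂ_[p] G B} {π' : Representation ℂ_[p] G B'}

theorem exists_continuousLinearEquiv_of_homothety {F : B →L[ℂ_[p]] B'} {r : ℝ} (hr : 0 < r)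
    (hF : ∀ v, ‖F v‖ = r * ‖v‖) (hs : Function.Surjective F) :
    ∃ e : B ≃L[ℂ_[p]] B', ∀ v, e v = F v := by
  have hinj : Function.Injective F := by
    refine (injective_iff_map_eq_zero F).mpr fun v hv => ?_
    have := hF v
    rw [hv, norm_zero, eq_comm, mul_eq_zero] at this
    exact norm_eq_zero.mp (this.resolve_left hr.ne')
  let e := LinearEquiv.ofBijective F.toLinearMap ⟨hinj, hs⟩
  refine ⟨e.toContinuousLinearEquivOfBounds r r⁻¹ (fun v => (hF v).le) fun w => ?_, fun v => rfl⟩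
  have h1 := hF (e.symm w)
  have h2 : F (e.symm w) = w := e.apply_symm_apply w
  rw [h2] at h1
  rw [h1, inv_mul_cancel_left₀ hr.ne']

theorem le_mul_of_forall_lt_imp_le_mul {x y a : ℝ} (h : ∀ ρ, a < ρ → x ≤ ρ * y) : x ≤ a * y := by
  refine ge_of_tendsto (x := nhdsWithin a (Set.Ioi a)) (f := fun ρ => ρ * y) ?_ ?_
  · exact ((continuous_id.mul continuous_const).tendsto _).mono_left nhdsWithin_le_nhds
  · filter_upwards [self_mem_nhdsWithin] with ρ hρ using h ρ hρ

/-- A map satisfying `‖F w‖ ‖u‖ ≤ ‖w‖ ‖F u‖` for all nonzero `u` is a homothety. -/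
theorem exists_homothety {F : B →L[ℂ_[p]] B'} (hF0 : F ≠ 0)
    (h : ∀ u w, u ≠ 0 → ‖F w‖ * ‖u‖ ≤ ‖w‖ * ‖F u‖) :
    ∃ r : ℝ, 0 < r ∧ ∀ v, ‖F v‖ = r * ‖v‖ := by
  obtain ⟨u, hu⟩ : ∃ u, F u ≠ 0 := by
    by_contra! h0
    exact hF0 (ContinuousLinearMap.ext h0)
  have hu0 : u ≠ 0 := by rintro rfl; exact hu (map_zero F)
  have hun := norm_pos_iff.mpr hu0
  refine ⟨‖F u‖ / ‖u‖, div_pos (norm_pos_iff.mpr hu) hun, fun v => ?_⟩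
  rcases eq_or_ne v 0 with rfl | hv
  · simp
  rw [div_mul_eq_mul_div, eq_div_iff hun.ne']
  -- The hypothesis is used twice, with `u` and `v` exchanged, so a one-sided inequality yields
  -- equality.
  exact le_antisymm ((h u v hu0).trans_eq (mul_comm _ _)) ((h v u hv).trans_eq (mul_comm _ _))

/-- Approximate `w` by a combination of translates of `u` with coefficients up to `ρ`. Its image is
bounded by `ρ ‖F u‖`, continuity controls the remainder, and `ρ` then decreases to `‖w‖ / ‖u‖`. -/
theorem IsStronglyIrreducible.exists_homothety (hπ : IsStronglyIrreducible π)
    (hπ' : IsBanachRep π') {F : B →L[ℂ_[p]] B'} (hF0 : F ≠ 0)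
    (hF : ∀ g v, F (π g v) = π' g (F v)) : ∃ r : ℝ, 0 < r ∧ ∀ v, ‖F v‖ = r * ‖v‖ := by
  refine PadicHeis.exists_homothety hF0 fun u w hu => ?_
  have hun := norm_pos_iff.mpr hu
  have key : ∀ ρ, ‖w‖ / ‖u‖ < ρ → ‖F w‖ ≤ ρ * ‖F u‖ := by
    intro ρ hρ
    have hρ0 : 0 ≤ ρ := (div_nonneg (norm_nonneg w) (norm_nonneg u)).trans hρ.le
    rw [div_lt_iff₀ hun] at hρ
    refine le_of_forall_pos_le_add fun ε hε => ?_
    obtain ⟨l, hl, hlε⟩ := hπ u w ρ hρ (ε / (‖F‖ + 1)) (by positivity)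
    have h1 := hπ'.norm_le_of_mem_orbitLattice hρ0
      (map_mem_orbitLattice (π' := π') F.toLinearMap (fun g => ⟨g, hF g u⟩) hl)
    have h2 : ‖F (w - l)‖ ≤ ε := by
      refine (F.le_opNorm _).trans ?_
      rw [lt_div_iff₀ (by positivity)] at hlε
      nlinarith [norm_nonneg F, norm_nonneg (w - l)]
    have h3 : F w = F l + F (w - l) := by rw [← map_add, add_sub_cancel]
    rw [h3]
    exact (norm_add_le _ _).trans (add_le_add h1 h2)
  have h1 : ‖F w‖ ≤ ‖w‖ / ‖u‖ * ‖F u‖ := le_mul_of_forall_lt_imp_le_mul key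
  rwa [div_mul_eq_mul_div, le_div_iff₀ hun] at h1

/-- A homothety from a complete space has closed range, and this range is a nonzero
subrepresentation. -/
theorem IsTopIrreducible.surjective_of_homothety [CompleteSpace B] (hπ' : IsTopIrreducible π')
    {F : B →L[ℂ_[p]] B'} (hF0 : F ≠ 0) (hF : ∀ g v, F (π g v) = π' g (F v)) {r : ℝ} (hr : 0 < r)
    (hFr : ∀ v, ‖F v‖ = r * ‖v‖) : Function.Surjective F := by
  have hclosed : IsClosed (Set.range F) := by
    refine (AntilipschitzWith.isClosed_range (K := ⟨r⁻¹, (inv_pos.mpr hr).le⟩) ?_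
      F.uniformContinuous)
    refine AddMonoidHomClass.antilipschitz_of_bound F fun v => ?_
    rw [hFr]
    exact (inv_mul_cancel_left₀ hr.ne' _).ge
  have h := hπ'.eq_bot_or_eq_top (LinearMap.range F.toLinearMap) hclosed (by
    rintro g _ ⟨v, rfl⟩
    exact ⟨π g v, hF g v⟩)
  rcases h with h | h
  · refine absurd (ContinuousLinearMap.ext fun v => ?_) hF0
    have : F v ∈ LinearMap.range F.toLinearMap := ⟨v, rfl⟩
    rw [h] at this
    exact this
  · exact LinearMap.range_eq_top.mp h

theorem IsTopIrreducible.injective (hπ : IsTopIrreducible π) {F : B →L[ℂ_[p]] B'} (hF0 : F ≠ 0)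
    (hF : ∀ g v, F (π g v) = π' g (F v)) : Function.Injective F := by
  rcases hπ.eq_bot_or_eq_top (LinearMap.ker F.toLinearMap) F.isClosed_ker (by
    intro g v hv
    change F (π g v) = 0
    rw [hF, show F v = 0 from hv, map_zero]) with h | h
  · exact LinearMap.ker_eq_bot.mp h
  · refine absurd (ContinuousLinearMap.ext fun v => ?_) hF0
    have : v ∈ LinearMap.ker F.toLinearMap := by rw [h]; trivial
    exact this

/-- An equivariant map from a Banach representation to a strongly irreducible one is surjective,
with control of the norm of a preimage. -/
theorem IsStronglyIrreducible.exists_preimage (hπ' : IsStronglyIrreducible π')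
    (hπ : IsBanachRep π) {F : B →L[ℂ_[p]] B'} (hF : ∀ g v, F (π g v) = π' g (F v)) {v : B}
    {w : B'} {ρ : ℝ} (hρ : ‖w‖ < ρ * ‖F v‖) : ∃ v', F v' = w ∧ ‖v'‖ ≤ ρ * ‖v‖ := by
  have := hπ.complete
  have hpos := (norm_nonneg w).trans_lt hρ
  have hρ0 : 0 < ρ := pos_of_mul_pos_left hpos (norm_nonneg _)
  have hFv : 0 < ‖F v‖ := pos_of_mul_pos_right hpos hρ0.le
  -- The conditions are placed after the existential so that `choose` gives a total function, usable
  -- in the recursion; outside them its value is irrelevant.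
  have step : ∀ (w : B') (σ : ℝ), ∃ l : B, 0 < σ → ‖w‖ < σ * ‖F v‖ →
      l ∈ orbitLattice π v σ ∧ ‖w - F l‖ < σ / 2 * ‖F v‖ := by
    intro w σ
    by_cases h : 0 < σ ∧ ‖w‖ < σ * ‖F v‖
    · obtain ⟨l, hl, hlw⟩ := hπ' (F v) w σ h.2 (σ / 2 * ‖F v‖) (mul_pos (half_pos h.1) hFv)
      obtain ⟨l', hl', rfl⟩ := exists_preimage_mem_orbitLattice hF hl
      exact ⟨l', fun _ _ => ⟨hl', hlw⟩⟩
    · exact ⟨0, fun h1 h2 => absurd ⟨h1, h2⟩ h⟩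
  choose l hl using step
  -- The `n`-th correction has coefficients at most `ρ / 2 ^ n`, so the series converges. All
  -- partial sums stay in the lattice for `ρ`, so the limit has norm at most `ρ ‖v‖`, with no
  -- constant lost.
  let y : ℕ → B := fun n => Nat.rec 0 (fun n y => y + l (w - F y) (ρ / 2 ^ n)) n
  have hy0 : y 0 = 0 := rfl
  have hysucc : ∀ n, y (n + 1) = y n + l (w - F (y n)) (ρ / 2 ^ n) := fun n => rfl
  have hσ : ∀ n : ℕ, 0 < ρ / 2 ^ n := fun n => by positivity
  have hw : ∀ n, ‖w - F (y n)‖ < ρ / 2 ^ n * ‖F v‖ := by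
    intro n
    induction n with
    | zero => simpa [hy0] using hρ
    | succ n ih =>
      have := (hl _ _ (hσ n) ih).2
      rw [hysucc, map_add, ← sub_sub, pow_succ, ← div_div]
      exact this
  have hmem : ∀ n, y n ∈ orbitLattice π v ρ := by
    intro n
    induction n with
    | zero => exact zero_mem _
    | succ n ih =>
      refine add_mem ih (orbitLattice_mono ?_ (hl _ _ (hσ n) (hw n)).1)
      exact div_le_self hρ0.le (one_le_pow₀ one_le_two)
  have hcauchy : CauchySeq y := by
    refine cauchySeq_of_le_geometric (1 / 2) (ρ * ‖v‖) one_half_lt_one fun n => ?_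
    rw [hysucc, dist_self_add_right]
    refine (hπ.norm_le_of_mem_orbitLattice (hσ n).le (hl _ _ (hσ n) (hw n)).1).trans_eq ?_
    rw [one_div, inv_pow]
    ring
  obtain ⟨v', hv'⟩ := cauchySeq_tendsto_of_complete hcauchy
  refine ⟨v', ?_, ?_⟩
  · have h1 : Filter.Tendsto (fun n => w - F (y n)) Filter.atTop (nhds (w - F v')) :=
      ((F.continuous.tendsto v').comp hv').const_sub w
    have h2 : Filter.Tendsto (fun n => w - F (y n)) Filter.atTop (nhds 0) := by
      refine squeeze_zero_norm (fun n => (hw n).le) ?_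
      have h3 : Filter.Tendsto (fun n : ℕ => ρ / 2 ^ n) Filter.atTop (nhds 0) :=
        tendsto_const_nhds.div_atTop (tendsto_pow_atTop_atTop_of_one_lt one_lt_two)
      simpa using h3.mul_const ‖F v‖
    exact (sub_eq_zero.mp (tendsto_nhds_unique h1 h2)).symm
  · exact le_of_tendsto hv'.norm (Filter.Eventually.of_forall fun n =>
      hπ.norm_le_of_mem_orbitLattice hρ0.le (hmem n))

theorem IsStronglyIrreducible.surjective (hπ' : IsStronglyIrreducible π') (hπ : IsBanachRep π)
    {F : B →L[ℂ_[p]] B'} (hF0 : F ≠ 0) (hF : ∀ g v, F (π g v) = π' g (F v)) :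
    Function.Surjective F := by
  intro w
  obtain ⟨v, hv⟩ : ∃ v, F v ≠ 0 := by
    by_contra! h0
    exact hF0 (ContinuousLinearMap.ext h0)
  have hFv := norm_pos_iff.mpr hv
  obtain ⟨v', hv', -⟩ := hπ'.exists_preimage hπ hF (v := v) (w := w) (ρ := (‖w‖ + 1) / ‖F v‖) (by
    rw [div_mul_cancel₀ _ hFv.ne']; linarith)
  exact ⟨v', hv'⟩

/-- By injectivity the controlled preimage of `F w` is `w` itself, whence `‖w‖ ≤ ρ ‖v‖` whenever `ρ
> ‖F w‖ / ‖F v‖`. -/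
theorem IsStronglyIrreducible.exists_homothety_of_injective (hπ' : IsStronglyIrreducible π')
    (hπ : IsBanachRep π) {F : B →L[ℂ_[p]] B'} (hF0 : F ≠ 0)
    (hF : ∀ g v, F (π g v) = π' g (F v)) (hinj : Function.Injective F) :
    ∃ r : ℝ, 0 < r ∧ ∀ v, ‖F v‖ = r * ‖v‖ := by
  refine PadicHeis.exists_homothety hF0 fun w v hw => ?_
  rcases eq_or_ne v 0 with rfl | hv
  · simp
  have hFv : 0 < ‖F v‖ := norm_pos_iff.mpr fun h => hv (hinj (by rw [h, map_zero]))
  have key : ∀ ρ, ‖F w‖ / ‖F v‖ < ρ → ‖w‖ ≤ ρ * ‖v‖ := by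
    intro ρ hρ
    rw [div_lt_iff₀ hFv] at hρ
    obtain ⟨v', hv', hle⟩ := hπ'.exists_preimage hπ hF hρ
    rwa [hinj hv'] at hle
  have h1 : ‖w‖ ≤ ‖F w‖ / ‖F v‖ * ‖v‖ := le_mul_of_forall_lt_imp_le_mul key
  rw [div_mul_eq_mul_div, le_div_iff₀ hFv] at h1
  linarith [mul_comm ‖F w‖ ‖v‖, mul_comm ‖w‖ ‖F v‖]

end Rigidity

end

end PadicHeis

/-- In both halves `r` rescales the norm of `B`, so it multiplies `‖v‖` when `B` is the source and
`‖F v‖` when it is the target; in the second case it is the inverse of the homothety ratio. -/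
theorem mainTheorem4 (p : ℕ) [Fact p.Prime] (d : ℕ) (hd : 1 ≤ d) (ψ : SmoothChar p)
    (α : Grassmannian p d) {B : Type*} [NormedAddCommGroup B] [NormedSpace ℂ_[p] B]
    (π : Representation ℂ_[p] (Heis p d) B) (hB : IsBanachRep π) (hirr : IsTopIrreducible π) :
    (∀ F : B →L[ℂ_[p]] AlphaCompletion ψ α,
      F ≠ 0 → (∀ (h : Heis p d) (v : B), F (π h v) = alphaRep ψ α h (F v)) →
        (∃ e : B ≃L[ℂ_[p]] AlphaCompletion ψ α, ∀ v : B, e v = F v) ∧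
          ∃ r : ℝ, 0 < r ∧ ∀ v : B, ‖F v‖ = r * ‖v‖) ∧
    (∀ F : AlphaCompletion ψ α →L[ℂ_[p]] B,
      F ≠ 0 → (∀ (h : Heis p d) (v : AlphaCompletion ψ α), F (alphaRep ψ α h v) = π h (F v)) →
        (∃ e : AlphaCompletion ψ α ≃L[ℂ_[p]] B, ∀ v : AlphaCompletion ψ α, e v = F v) ∧
          ∃ r : ℝ, 0 < r ∧ ∀ v : AlphaCompletion ψ α, r * ‖F v‖ = ‖v‖) := by
  have hα := isStronglyIrreducible_alphaRep ψ α
  refine ⟨fun F hF0 hF => ?_, fun F hF0 hF => ?_⟩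
  · obtain ⟨r, hr, hFr⟩ := hα.exists_homothety_of_injective hB hF0 hF (hirr.injective hF0 hF)
    exact ⟨exists_continuousLinearEquiv_of_homothety hr hFr (hα.surjective hB hF0 hF), r, hr, hFr⟩
  · obtain ⟨r, hr, hFr⟩ := hα.exists_homothety hB hF0 hF
    refine ⟨exists_continuousLinearEquiv_of_homothety hr hFr
      (hirr.surjective_of_homothety hF0 hF hr hFr), r⁻¹, inv_pos.mpr hr, fun v => ?_⟩
    rw [hFr, inv_mul_cancel_left₀ hr.ne']
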